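/- Let $k$ be an algebraically closed field and let $n\ge 2$. All indices $i,u$ are taken in $\mathbb Z/n\mathbb Z$. Let $Q_n$ be the quiver with vertices $(i,u)\in\mathbb Z/n\mathbb Z\times\mathbb Z/n\mathbb Z$ and arrows $$a_{i,u}:(i-1,u)\to(i,u)\quad (u\neq i-1),\qquad b_{i,u}:(i,u-1)\to(i,u)\quad (u\neq i).$$ In the path algebra $kQ_n$ paths are composed from left to right. Let $\Gamma=\Gamma_{\Lambda_n}$ (the Auslander algebra of the Taft algebra $\Lambda_n$) be the quotient of $kQ_n$ by the two-sided ideal generated by the mesh relations $a_{i,i-2}\,b_{i,i-1}=0$ for all $i$, and $a_{i,u-1}b_{i,u}+b_{i-1,u}a_{i,u}=0$ for all $(i,u)$ with $u\ne i$ and $u\neq i-1$. Write $e_{i,u}\in\Gamma$ for the idempotent at the vertex $(i,u)$ and $\otimes=\otimes_k$, and put $$R_0=\bigoplus_{(i,u)}\Gamma e_{i,u}\otimes e_{i,u}\Gamma,\qquad R_1=\bigoplus_{\substack{(i,u)\\ u\ne i-1}}\Gamma e_{i-1,u}\otimes e_{i,u}\Gamma\ \oplus\ \bigoplus_{\substack{(i,u)\\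 u\neq i}}\Gamma e_{i,u-1}\otimes e_{i,u}\Gamma,$$ $$R_2=\bigoplus_{\substack{(i,u)\\ i\neq u}}\Gamma e_{i-1,u-1}\otimes e_{i,u}\Gamma .$$ Then $R_2\neq 0$, and there are homomorphisms of $\Gamma$-bimodules such that $$0\to R_2\to R_1\to R_0\to\Gamma\to 0$$ is a minimal projective resolution of $\Gamma$ as a $\Gamma$-bimodule: the sequence is exact, the $R_p$ are projective $\Gamma$-bimodules (i.e. projective modules over $\Gamma\otimes\Gamma^{\mathrm{op}}$), and the kernel of each of the maps starting at $R_0$, $R_1$, $R_2$ is a superfluous sub-bimodule (a sub-bimodule $N\subseteq R$ is superfluous if $N+L=R$ implies $L=R$ for every sub-bimodule $L$). -/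

import Mathlib

open scoped TensorProduct DirectSum

noncomputable section

/-! ## Path algebras -/

/-- The underlying vector space of the path algebra `kQ` of a quiver `Q` with vertex set `V`:
the `k`-vector space with basis the set of all (directed) paths of `Q`. -/
def PathAlgebra (k : Type*) [Field k] (V : Type*) [Quiver V] :=
  (Σ a b : V, Quiver.Path a b) →₀ k

namespace PathAlgebra

variable {k : Type*} [Field k] {V : Type*} [Quiver V]

instance : AddCommGroup (PathAlgebra k V) :=
  inferInstanceAs (AddCommGroup ((Σ a b : V, Quiver.Path a b) →₀ k))

instance : Module k (PathAlgebra k V) :=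
  inferInstanceAs (Module k ((Σ a b : V, Quiver.Path a b) →₀ k))

/-- A path, as a basis element of the path algebra. -/
def ofPath {a b : V} (p : Quiver.Path a b) : PathAlgebra k V :=
  Finsupp.single ⟨a, b, p⟩ 1

open Classical in
/-- The product of two basis elements: the concatenation "first `p`, then `q`" if `p` ends where
`q` starts, and zero otherwise. -/
def mulPath (p q : Σ a b : V, Quiver.Path a b) : PathAlgebra k V :=
  if h : q.1 = p.2.1 then ofPath (p.2.2.comp (q.2.2.cast h rfl)) else 0

/-- The linear map with given values on the basis of paths. -/
def lift {M : Type*} [AddCommGroup M] [Module k M] (f : (Σ a b : V, Quiver.Path a b) → M) :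
    PathAlgebra k V →ₗ[k] M :=
  Finsupp.linearCombination k f

theorem lift_ofPath {M : Type*} [AddCommGroup M] [Module k M]
    (f : (Σ a b : V, Quiver.Path a b) → M) {a b : V} (p : Quiver.Path a b) :
    lift f (ofPath p : PathAlgebra k V) = f ⟨a, b, p⟩ :=
  (Finsupp.linearCombination_single k (1 : k) _).trans (one_smul k _)

/-- The bilinear extension of the product of paths. -/
def mulHom : PathAlgebra k V →ₗ[k] PathAlgebra k V →ₗ[k] PathAlgebra k V :=
  lift fun p => lift fun q => mulPath p q

instance : Mul (PathAlgebra k V) := ⟨fun x y => mulHom x y⟩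

theorem mul_def (x y : PathAlgebra k V) : x * y = mulHom x y := rfl

theorem ofPath_mul_ofPath {a b c : V} (p : Quiver.Path a b) (q : Quiver.Path b c) :
    (ofPath p * ofPath q : PathAlgebra k V) = ofPath (p.comp q) := by
  rw [mul_def, mulHom, lift_ofPath, lift_ofPath]
  simp [mulPath]

theorem ofPath_mul_ofPath_of_ne {a b c d : V} (p : Quiver.Path a b) (q : Quiver.Path c d)
    (h : c ≠ b) : (ofPath p * ofPath q : PathAlgebra k V) = 0 := by
  rw [mul_def, mulHom, lift_ofPath, lift_ofPath]
  simp [mulPath, h]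

theorem induction_on {P : PathAlgebra k V → Prop} (x : PathAlgebra k V) (h0 : P 0)
    (hadd : ∀ x y, P x → P y → P (x + y))
    (hpath : ∀ (r : k) (a b : V) (p : Quiver.Path a b), P (r • ofPath p)) : P x := by
  refine Finsupp.induction_linear x h0 hadd ?_
  rintro ⟨a, b, p⟩ r
  have h : (r • ofPath p : PathAlgebra k V) = Finsupp.single ⟨a, b, p⟩ r :=
    Finsupp.smul_single_one _ r
  exact h ▸ hpath r a b p

protected theorem add_mul (x y z : PathAlgebra k V) : (x + y) * z = x * z + y * z := by
  simp [mul_def]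

protected theorem mul_add (x y z : PathAlgebra k V) : x * (y + z) = x * y + x * z := by
  simp [mul_def]

protected theorem zero_mul (x : PathAlgebra k V) : 0 * x = 0 := by
  simp [mul_def]

protected theorem mul_zero (x : PathAlgebra k V) : x * 0 = 0 := by
  simp [mul_def]

protected theorem smul_mul (r : k) (x y : PathAlgebra k V) : (r • x) * y = r • (x * y) := by
  simp [mul_def]

protected theorem mul_smul (r : k) (x y : PathAlgebra k V) : x * (r • y) = r • (x * y) := by
  simp [mul_def]

protected theorem mul_assoc (x y z : PathAlgebra k V) : x * y * z = x * (y * z) := by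
  induction x using induction_on with
  | h0 => simp only [PathAlgebra.zero_mul]
  | hadd x x' hx hx' => simp only [PathAlgebra.add_mul, hx, hx']
  | hpath r a b p =>
    induction y using induction_on with
    | h0 => simp only [PathAlgebra.zero_mul, PathAlgebra.mul_zero]
    | hadd y y' hy hy' => simp only [PathAlgebra.add_mul, PathAlgebra.mul_add, hy, hy']
    | hpath s c d q =>
      induction z using induction_on with
      | h0 => simp only [PathAlgebra.mul_zero]
      | hadd z z' hz hz' => simp only [PathAlgebra.mul_add, hz, hz']
      | hpath t e f w =>
        simp only [PathAlgebra.smul_mul, PathAlgebra.mul_smul]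
        congr 3
        by_cases h1 : c = b
        · subst h1
          rw [ofPath_mul_ofPath]
          by_cases h2 : e = d
          · subst h2
            rw [ofPath_mul_ofPath, ofPath_mul_ofPath, ofPath_mul_ofPath, Quiver.Path.comp_assoc]
          · rw [ofPath_mul_ofPath_of_ne _ _ h2, ofPath_mul_ofPath_of_ne _ _ h2,
              PathAlgebra.mul_zero]
        · rw [ofPath_mul_ofPath_of_ne _ _ h1, PathAlgebra.zero_mul]
          by_cases h2 : e = d
          · subst h2
            rw [ofPath_mul_ofPath, ofPath_mul_ofPath_of_ne _ _ h1]
          · rw [ofPath_mul_ofPath_of_ne _ _ h2, PathAlgebra.mul_zero]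

variable [Fintype V]

/-- The unit of the path algebra of a quiver with finitely many vertices is the sum of the
trivial paths. -/
instance : One (PathAlgebra k V) := ⟨∑ v : V, ofPath (Quiver.Path.nil : Quiver.Path v v)⟩

theorem one_def : (1 : PathAlgebra k V) = ∑ v : V, ofPath (Quiver.Path.nil : Quiver.Path v v) :=
  rfl

protected theorem one_mul (x : PathAlgebra k V) : 1 * x = x := by
  induction x using induction_on with
  | h0 => rw [PathAlgebra.mul_zero]
  | hadd x y hx hy => rw [PathAlgebra.mul_add, hx, hy]
  | hpath r a b p =>
    rw [PathAlgebra.mul_smul, one_def, mul_def, map_sum, LinearMap.sum_apply,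
      Finset.sum_eq_single a]
    · rw [← mul_def, ofPath_mul_ofPath, Quiver.Path.nil_comp]
    · intro c _ hc
      rw [← mul_def, ofPath_mul_ofPath_of_ne _ _ (Ne.symm hc)]
    · simp

protected theorem mul_one (x : PathAlgebra k V) : x * 1 = x := by
  induction x using induction_on with
  | h0 => rw [PathAlgebra.zero_mul]
  | hadd x y hx hy => rw [PathAlgebra.add_mul, hx, hy]
  | hpath r a b p =>
    rw [PathAlgebra.smul_mul, one_def, mul_def, map_sum, Finset.sum_eq_single b]
    · rw [← mul_def, ofPath_mul_ofPath, Quiver.Path.comp_nil]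
    · intro c _ hc
      rw [← mul_def, ofPath_mul_ofPath_of_ne _ _ hc]
    · simp

instance : Ring (PathAlgebra k V) :=
  { (inferInstance : AddCommGroup (PathAlgebra k V)),
    (inferInstance : Mul (PathAlgebra k V)),
    (inferInstance : One (PathAlgebra k V)) with
    left_distrib := PathAlgebra.mul_add
    right_distrib := PathAlgebra.add_mul
    zero_mul := PathAlgebra.zero_mul
    mul_zero := PathAlgebra.mul_zero
    mul_assoc := PathAlgebra.mul_assoc
    one_mul := PathAlgebra.one_mul
    mul_one := PathAlgebra.mul_one }

instance : Algebra k (PathAlgebra k V) :=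
  Algebra.ofModule PathAlgebra.smul_mul (fun r x y => PathAlgebra.mul_smul r x y)

end PathAlgebra

/-! ## Bimodules and minimal projective resolutions -/

section Bimodules

variable (k : Type*) [Field k] (A : Type*) [Ring A] [Algebra k A]

/-- The enveloping algebra of `A`; its left modules are the `A`-bimodules (with `k` acting
centrally). -/
abbrev EnvelopingAlgebra := A ⊗[k] Aᵐᵒᵖ

/-- `A` as an `A`-bimodule: `(x ⊗ y) • m = x * m * y`. -/
instance envelopingAlgebraModuleSelf : Module (EnvelopingAlgebra k A) A :=
  instModuleTensorProductMop k A

variable {A}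

/-- The `k`-vector space `A e ⊗ₖ f A`, where `A e` is the left ideal generated by `e` and
`f A` is the right ideal generated by `f`. -/
def OuterBimodule (e f : A) :=
  (Submodule.span A {e}) ⊗[k] (Submodule.span Aᵐᵒᵖ {f})

namespace OuterBimodule

variable (e f : A)

instance : AddCommGroup (OuterBimodule k e f) :=
  inferInstanceAs (AddCommGroup ((Submodule.span A {e}) ⊗[k] (Submodule.span Aᵐᵒᵖ {f})))

instance : Module k (OuterBimodule k e f) :=
  inferInstanceAs (Module k ((Submodule.span A {e}) ⊗[k] (Submodule.span Aᵐᵒᵖ {f})))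

/-- The action of the enveloping algebra on `A e ⊗ₖ f A`:
`x ⊗ y` acts by `m ⊗ n ↦ (x * m) ⊗ (n * y)`. -/
def action : EnvelopingAlgebra k A →ₐ[k]
    Module.End k ((Submodule.span A {e}) ⊗[k] (Submodule.span Aᵐᵒᵖ {f})) :=
  (Module.endTensorEndAlgHom (R := k) (S := k) (A := k)).comp
    (Algebra.TensorProduct.map (Algebra.lsmul k k (Submodule.span A {e}))
      (Algebra.lsmul k k (Submodule.span Aᵐᵒᵖ {f})))

/-- The outer bimodule structure on `A e ⊗ₖ f A`. -/
instance : Module (EnvelopingAlgebra k A) (OuterBimodule k e f) :=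
  Module.compHom ((Submodule.span A {e}) ⊗[k] (Submodule.span Aᵐᵒᵖ {f}))
    (action k e f).toRingHom

/-- The pure tensor `m ⊗ n` in `A e ⊗ₖ f A`. -/
def tmul (m : Submodule.span A {e}) (n : Submodule.span Aᵐᵒᵖ {f}) : OuterBimodule k e f :=
  m ⊗ₜ[k] n

theorem smul_tmul (x : A) (y : Aᵐᵒᵖ) (m : Submodule.span A {e}) (n : Submodule.span Aᵐᵒᵖ {f}) :
    (x ⊗ₜ[k] y : EnvelopingAlgebra k A) • tmul k e f m n = tmul k e f (x • m) (y • n) :=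
  rfl

end OuterBimodule

end Bimodules

/-- A submodule `N` of `M` is superfluous if `N + L = M` forces `L = M`. -/
def Submodule.IsSuperfluous {R M : Type*} [Ring R] [AddCommGroup M] [Module R M]
    (N : Submodule R M) : Prop :=
  ∀ L : Submodule R M, N ⊔ L = ⊤ → L = ⊤

/-- `0 → R₂ → R₁ → R₀ → M → 0` is a minimal projective resolution of the `R`-module `M`: it is
exact, the `Rᵢ` are projective, and each of them is a projective cover of its image, that is, the
kernel of each of the maps `ε`, `d₁`, `d₂` is superfluous. -/
structure IsMinimalProjectiveResolution {R M R₀ R₁ R₂ : Type*} [Ring R]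
    [AddCommGroup M] [Module R M] [AddCommGroup R₀] [Module R R₀] [AddCommGroup R₁] [Module R R₁]
    [AddCommGroup R₂] [Module R R₂]
    (d₂ : R₂ →ₗ[R] R₁) (d₁ : R₁ →ₗ[R] R₀) (ε : R₀ →ₗ[R] M) : Prop where
  projective_zero : Module.Projective R R₀
  projective_one : Module.Projective R R₁
  projective_two : Module.Projective R R₂
  injective : Function.Injective d₂
  exact_one : Function.Exact d₂ d₁
  exact_zero : Function.Exact d₁ ε
  surjective : Function.Surjective ε
  minimal_zero : ε.ker.IsSuperfluous
  minimal_one : d₁.ker.IsSuperfluous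
  minimal_two : d₂.ker.IsSuperfluous

/-! ## The quiver with relations of the Auslander algebra of the Taft algebra -/

namespace TaftAuslander

/-- The vertices of the quiver `Q_n` are indexed by `(i, u)` in `ℤ/n × ℤ/n`. -/
def Vertex (n : ℕ) := ZMod n × ZMod n

instance (n : ℕ) [NeZero n] : Fintype (Vertex n) := inferInstanceAs (Fintype (ZMod n × ZMod n))

/-- The vertex `(i, u)`. -/
def vtx {n : ℕ} (i u : ZMod n) : Vertex n := (i, u)

/-- The arrows of `Q_n`: `a_{i,u} : (i-1, u) → (i, u)` for `u ≠ i - 1`, and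
`b_{i,u} : (i, u-1) → (i, u)` for `u ≠ i`. -/
inductive Arrow (n : ℕ) : Vertex n → Vertex n → Type
  | a (i u : ZMod n) (h : u ≠ i - 1) : Arrow n (vtx (i - 1) u) (vtx i u)
  | b (i u : ZMod n) (h : u ≠ i) : Arrow n (vtx i (u - 1)) (vtx i u)

instance (n : ℕ) : Quiver (Vertex n) := ⟨Arrow n⟩

section

variable (k : Type*) [Field k] {n : ℕ}

/-- The arrow `a_{i,u}` as an element of the path algebra. -/
def pa (i u : ZMod n) (h : u ≠ i - 1) : PathAlgebra k (Vertex n) :=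
  PathAlgebra.ofPath (Quiver.Hom.toPath (Arrow.a i u h : vtx (i - 1) u ⟶ vtx i u))

/-- The arrow `b_{i,u}` as an element of the path algebra. -/
def pb (i u : ZMod n) (h : u ≠ i) : PathAlgebra k (Vertex n) :=
  PathAlgebra.ofPath (Quiver.Hom.toPath (Arrow.b i u h : vtx i (u - 1) ⟶ vtx i u))

variable (n)

/-- The mesh relations: `a_{i,i-2} b_{i,i-1} = 0` for all `i`, and
`a_{i,u-1} b_{i,u} + b_{i-1,u} a_{i,u} = 0` for all squares, i.e. for all `i`, `u` for which the
four arrows exist. -/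
inductive MeshRel : PathAlgebra k (Vertex n) → PathAlgebra k (Vertex n) → Prop
  | triangle (i : ZMod n) (ha : i - 2 ≠ i - 1) (hb : i - 1 ≠ i) :
      MeshRel (pa k i (i - 2) ha * pb k i (i - 1) hb) 0
  | square (i u : ZMod n) (ha : u - 1 ≠ i - 1) (hb : u ≠ i) (hb' : u ≠ i - 1)
      (ha' : u ≠ i - 1) :
      MeshRel (pa k i (u - 1) ha * pb k i u hb + pb k (i - 1) u hb' * pa k i u ha') 0

variable [NeZero n]

/-- The algebra `Γ`: the quotient of the path algebra `k Q_n` by the two-sided ideal generated by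
the mesh relations. -/
abbrev Gam := RingQuot (MeshRel k n)

variable {n}

/-- The idempotent `e_{i,u}` of `Γ`. -/
def idem (i u : ZMod n) : Gam k n :=
  RingQuot.mkAlgHom k (MeshRel k n)
    (PathAlgebra.ofPath (Quiver.Path.nil : Quiver.Path (vtx i u) (vtx i u)))

/-- The `Γ`-bimodule `Γ e_{j,v} ⊗ₖ e_{i,u} Γ`. -/
abbrev ProjBimod (j v i u : ZMod n) := OuterBimodule k (idem k j v) (idem k i u)

variable (n)

/-- `R₀ = ⨁_{(i,u)} Γ e_{i,u} ⊗ e_{i,u} Γ`. -/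
abbrev R₀ := ⨁ x : ZMod n × ZMod n, ProjBimod k x.1 x.2 x.1 x.2

/-- `R₁ = ⨁_{(i,u), u ≠ i-1} Γ e_{i-1,u} ⊗ e_{i,u} Γ ⊕ ⨁_{(i,u), u ≠ i} Γ e_{i,u-1} ⊗ e_{i,u} Γ`;
the summands correspond to the arrows `a_{i,u}` and `b_{i,u}` of the quiver. -/
abbrev R₁ :=
  (⨁ x : {x : ZMod n × ZMod n // x.2 ≠ x.1 - 1},
      ProjBimod k (x.1.1 - 1) x.1.2 x.1.1 x.1.2) ×
  (⨁ x : {x : ZMod n × ZMod n // x.2 ≠ x.1},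
      ProjBimod k x.1.1 (x.1.2 - 1) x.1.1 x.1.2)

/-- `R₂ = ⨁_{(i,u), i ≠ u} Γ e_{i-1,u-1} ⊗ e_{i,u} Γ`. -/
abbrev R₂ :=
  ⨁ x : {x : ZMod n × ZMod n // x.1 ≠ x.2},
    ProjBimod k (x.1.1 - 1) (x.1.2 - 1) x.1.1 x.1.2

end

end TaftAuslander

end

/-!
By the mesh relations, every path of `Q_n` equals, up to sign, a word consisting of arrows `b`
followed by arrows `a`, or is zero. The words that are paths of `Q_n` form a basis of `Γ`: they are
separated by their end points, and they act nontrivially in a representation of `Γ` on sequences.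

Let `d₂` and `d₁` differentiate the mesh relations and the arrows, as for any algebra given by
generators and relations. The complex of bimodules `R₂ → R₁ → R₀ → Γ` has a contracting homotopy of
left modules, which is defined on the basis of words: in degree `0` it replaces each arrow of a
word by the corresponding generator of `R₁`, and in degree `1` it records the meshes that are
crossed when an arrow `a` is moved past the arrows `b` of a word.

The words of positive length span a nilpotent ideal `J` of `Γ`, and so `J ⊗ Γᵒᵖ + Γ ⊗ Jᵒᵖ` lies in
the Jacobson radical of the enveloping algebra. The images of `d₁` and `d₂` are contained in the
Jacobson radicals of `R₀` and `R₁`, which are superfluous since these modules are finitely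
generated.
-/

noncomputable section

open MulOpposite
open scoped RightActions

section Superfluous

variable {R M : Type*} [Ring R] [AddCommGroup M] [Module R M]

theorem isSuperfluous_of_le_jacobson [IsCoatomic (Submodule R M)] {N : Submodule R M}
    (hN : N ≤ Module.jacobson R M) : N.IsSuperfluous := by
  intro L hL
  by_contra hne
  obtain ⟨m, hm, hLm⟩ := (eq_top_or_exists_le_coatom L).resolve_left hne
  exact hm.1 (top_le_iff.1 (hL ▸ sup_le (hN.trans (sInf_le hm)) hLm))

theorem IsMinimalProjectiveResolution.of_contractingHomotopy {R₀ R₁ R₂ : Type*}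
    [AddCommGroup R₀] [Module R R₀] [AddCommGroup R₁] [Module R R₁] [AddCommGroup R₂] [Module R R₂]
    [Module.Projective R R₀] [Module.Projective R R₁] [Module.Projective R R₂]
    [Module.Finite R R₀] [Module.Finite R R₁]
    {d₂ : R₂ →ₗ[R] R₁} {d₁ : R₁ →ₗ[R] R₀} {ε : R₀ →ₗ[R] M}
    (ε_d₁ : ∀ x, ε (d₁ x) = 0) (d₁_d₂ : ∀ x, d₁ (d₂ x) = 0)
    (σ : M →+ R₀) (h₀ : R₀ →+ R₁) (h₁ : R₁ →+ R₂)
    (ε_σ : ∀ x, ε (σ x) = x) (homotopy_zero : ∀ x, d₁ (h₀ x) + σ (ε x) = x)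
    (homotopy_one : ∀ x, d₂ (h₁ x) + h₀ (d₁ x) = x) (h₁_d₂ : ∀ x, h₁ (d₂ x) = x)
    (range_d₁ : d₁.range ≤ Module.jacobson R R₀) (range_d₂ : d₂.range ≤ Module.jacobson R R₁) :
    IsMinimalProjectiveResolution d₂ d₁ ε := by
  have exact_zero : Function.Exact d₁ ε := fun x =>
    ⟨fun hx => ⟨h₀ x, by simpa [hx] using homotopy_zero x⟩, by rintro ⟨y, rfl⟩; exact ε_d₁ y⟩
  have exact_one : Function.Exact d₂ d₁ := fun x =>
    ⟨fun hx => ⟨h₁ x, by simpa [hx] using homotopy_one x⟩, by rintro ⟨y, rfl⟩; exact d₁_d₂ y⟩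
  have injective : Function.Injective d₂ := Function.LeftInverse.injective h₁_d₂
  exact
    { projective_zero := inferInstance
      projective_one := inferInstance
      projective_two := inferInstance
      injective
      exact_one
      exact_zero
      surjective := fun x => ⟨σ x, ε_σ x⟩
      minimal_zero := isSuperfluous_of_le_jacobson (exact_zero.linearMap_ker_eq.trans_le range_d₁)
      minimal_one := isSuperfluous_of_le_jacobson (exact_one.linearMap_ker_eq.trans_le range_d₂)
      minimal_two := fun L hL => by rwa [LinearMap.ker_eq_bot.2 injective, bot_sup_eq] at hL }

end Superfluous

section Jacobson

theorem mem_jacobson_of_forall_isNilpotent {R : Type*} [Ring R] {x : R}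
    (hx : ∀ y, IsNilpotent (y * x)) : x ∈ Ring.jacobson R := by
  rw [← Ideal.jacobson_bot, Ideal.mem_jacobson_iff]
  intro y
  obtain ⟨v, hv⟩ := (hx y).isUnit_one_add
  refine ⟨↑v⁻¹, Submodule.mem_bot R |>.2 ?_⟩
  calc ↑v⁻¹ * y * x + ↑v⁻¹ - 1 = ↑v⁻¹ * (1 + y * x) - 1 := by noncomm_ring
    _ = 0 := by rw [← hv, v.inv_mul, sub_self]

variable {k A : Type*} [CommRing k] [Ring A] [Algebra k A]

theorem top_mul_pow_le {S : Submodule k A} (hS : S * ⊤ ≤ ⊤ * S) (m : ℕ) :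
    (⊤ * S) ^ m ≤ ⊤ * S ^ m := by
  induction m with
  | zero => simp
  | succ m ih =>
    calc (⊤ * S) ^ (m + 1) = ⊤ * S * (⊤ * S) ^ m := pow_succ' ..
      _ ≤ ⊤ * S * (⊤ * S ^ m) := by gcongr
      _ = ⊤ * (S * ⊤) * S ^ m := by simp only [mul_assoc]
      _ ≤ ⊤ * (⊤ * S) * S ^ m := by gcongr
      _ = ⊤ * ⊤ * S ^ (m + 1) := by simp only [mul_assoc, pow_succ']
      _ ≤ ⊤ * S ^ (m + 1) := by gcongr; exact le_top

theorem mem_jacobson_of_pow_eq_bot {S : Submodule k A} (hS : S * ⊤ ≤ ⊤ * S) {N : ℕ}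
    (hN : S ^ N = ⊥) {x : A} (hx : x ∈ S) : x ∈ Ring.jacobson A :=
  mem_jacobson_of_forall_isNilpotent fun y => ⟨N, by
    have h := top_mul_pow_le hS N (Submodule.pow_mem_pow _ (Submodule.mul_mem_mul
      (Submodule.mem_top (x := y)) hx) N)
    simpa [hN] using h⟩

section Enveloping

variable {J : Submodule k A} {N : ℕ}

theorem tmul_one_mem_jacobson (hJ : J * ⊤ ≤ J) (hN : J ^ N = ⊥) {x : A} (hx : x ∈ J) :
    (x ⊗ₜ 1 : A ⊗[k] Aᵐᵒᵖ) ∈ Ring.jacobson (A ⊗[k] Aᵐᵒᵖ) := by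
  let ι : A →ₐ[k] A ⊗[k] Aᵐᵒᵖ := Algebra.TensorProduct.includeLeft
  refine mem_jacobson_of_pow_eq_bot (S := J.map ι.toLinearMap) (N := N) ?_
    (by rw [← Submodule.map_pow, hN, Submodule.map_bot]) ⟨x, hx, rfl⟩
  rw [Submodule.mul_le]
  rintro _ ⟨y, hy, rfl⟩ z -
  induction z with
  | zero => simp
  | add z z' hz hz' => rw [mul_add]; exact add_mem hz hz'
  | tmul a b =>
    have h : ι y * a ⊗ₜ b = (1 ⊗ₜ b) * ι (y * a) := by simp [ι]
    exact h ▸ Submodule.mul_mem_mul Submodule.mem_top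
      ⟨y * a, hJ (Submodule.mul_mem_mul hy Submodule.mem_top), rfl⟩

theorem one_tmul_op_mem_jacobson (hJ : ⊤ * J ≤ J) (hN : J ^ N = ⊥) {x : A} (hx : x ∈ J) :
    (1 ⊗ₜ op x : A ⊗[k] Aᵐᵒᵖ) ∈ Ring.jacobson (A ⊗[k] Aᵐᵒᵖ) := by
  let ι : Aᵐᵒᵖ →ₐ[k] A ⊗[k] Aᵐᵒᵖ := Algebra.TensorProduct.includeRight
  refine mem_jacobson_of_pow_eq_bot (N := N)
    (S := (J.map (opLinearEquiv k : A ≃ₗ[k] Aᵐᵒᵖ).toLinearMap).map ι.toLinearMap) ?_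
    (by rw [← Submodule.map_pow, ← Submodule.map_op_pow, hN, Submodule.map_bot, Submodule.map_bot])
    ⟨op x, ⟨x, hx, rfl⟩, rfl⟩
  rw [Submodule.mul_le]
  rintro _ ⟨_, ⟨y, hy, rfl⟩, rfl⟩ z -
  induction z with
  | zero => simp
  | add z z' hz hz' => rw [mul_add]; exact add_mem hz hz'
  | tmul a b =>
    have h : ι (op y) * a ⊗ₜ b = (a ⊗ₜ 1) * ι (op (b.unop * y)) := by simp [ι]
    exact h ▸ Submodule.mul_mem_mul Submodule.mem_top
      ⟨_, ⟨_, hJ (Submodule.mul_mem_mul Submodule.mem_top hy), rfl⟩, rfl⟩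

end Enveloping

end Jacobson

section Bimodule

variable {k A : Type*} [Field k] [Ring A] [Algebra k A]

/-- The module structure of `M` over the enveloping algebra is the one assembled from a left and
a right action of `A` on `M`, so that one can calculate with the two actions separately. -/
class IsBimodule (k A M : Type*) [Field k] [Ring A] [Algebra k A] [AddCommGroup M] [Module A M]
    [Module Aᵐᵒᵖ M] [Module (EnvelopingAlgebra k A) M] : Prop where
  tmul_smul (x : A) (y : Aᵐᵒᵖ) (m : M) : (x ⊗ₜ y : EnvelopingAlgebra k A) • m = x • y • m

theorem map_smul_of_forall_tmul {M N : Type*} [AddCommGroup M] [Module (EnvelopingAlgebra k A) M]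
    [AddCommGroup N] [Module (EnvelopingAlgebra k A) N] (φ : M →+ N)
    (h : ∀ (x : A) (y : Aᵐᵒᵖ) (m : M),
      φ ((x ⊗ₜ y : EnvelopingAlgebra k A) • m) = (x ⊗ₜ y : EnvelopingAlgebra k A) • φ m)
    (z : EnvelopingAlgebra k A) (m : M) : φ (z • m) = z • φ m := by
  induction z using TensorProduct.induction_on with
  | zero => simpa only [TensorProduct.zero_tmul, zero_smul, map_zero] using h 0 0 m
  | add z z' hz hz' => rw [add_smul, add_smul, map_add, hz, hz']
  | tmul x y => exact h x y m

namespace IsBimodule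

instance : IsBimodule k A A where
  tmul_smul x y m := TensorProduct.Algebra.smul_def x y m

variable {M N : Type*}
  [AddCommGroup M] [Module A M] [Module Aᵐᵒᵖ M] [Module (EnvelopingAlgebra k A) M]
  [AddCommGroup N] [Module A N] [Module Aᵐᵒᵖ N] [Module (EnvelopingAlgebra k A) N]
  [IsBimodule k A M] [IsBimodule k A N]

instance : IsBimodule k A (M × N) where
  tmul_smul x y m := Prod.ext (tmul_smul x y m.1) (tmul_smul x y m.2)

instance {ι : Type*} {M : ι → Type*} [∀ i, AddCommGroup (M i)] [∀ i, Module A (M i)]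
    [∀ i, Module Aᵐᵒᵖ (M i)] [∀ i, Module (EnvelopingAlgebra k A) (M i)]
    [∀ i, IsBimodule k A (M i)] : IsBimodule k A (⨁ i, M i) where
  tmul_smul x y m := DFinsupp.ext fun i => tmul_smul x y (m i)

theorem tmul_one_smul (x : A) (m : M) : (x ⊗ₜ 1 : EnvelopingAlgebra k A) • m = x • m := by
  rw [tmul_smul, one_smul]

theorem one_tmul_smul (y : Aᵐᵒᵖ) (m : M) : (1 ⊗ₜ y : EnvelopingAlgebra k A) • m = y • m := by
  rw [tmul_smul, one_smul]

/-- A bimodule homomorphism, as a homomorphism of left modules. -/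
def toLeft (φ : M →ₗ[EnvelopingAlgebra k A] N) : M →ₗ[A] N where
  __ := φ
  map_smul' x m := by simp [← tmul_one_smul (k := k)]

/-- A bimodule homomorphism, as a homomorphism of right modules. -/
def toRight (φ : M →ₗ[EnvelopingAlgebra k A] N) : M →ₗ[Aᵐᵒᵖ] N where
  __ := φ
  map_smul' y m := by simp [← one_tmul_smul (k := k)]

theorem map_smul_left (φ : M →ₗ[EnvelopingAlgebra k A] N) (x : A) (m : M) :
    φ (x • m) = x • φ m := (toLeft φ).map_smul x m

theorem map_smul_right (φ : M →ₗ[EnvelopingAlgebra k A] N) (m : M) (x : A) :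
    φ (m <• x) = φ m <• x := (toRight φ).map_smul (op x) m

theorem smul_op_smul [Module k M] [IsScalarTower k A M] (c : k) (y : A) (m : M) :
    m <• (c • y) = c • (m <• y) := by
  rw [← one_tmul_smul (k := k), op_smul, ← TensorProduct.smul_tmul, tmul_smul, smul_assoc,
    one_smul]

end IsBimodule

end Bimodule

namespace OuterBimodule

variable (k : Type*) {A : Type*} [Field k] [Ring A] [Algebra k A] (e f : A)

instance : Module A (OuterBimodule k e f) :=
  Module.compHom _ (Algebra.TensorProduct.includeLeftRingHom : A →+* EnvelopingAlgebra k A)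

instance : Module Aᵐᵒᵖ (OuterBimodule k e f) :=
  Module.compHom _
    (Algebra.TensorProduct.includeRight : Aᵐᵒᵖ →ₐ[k] EnvelopingAlgebra k A).toRingHom

instance : IsBimodule k A (OuterBimodule k e f) where
  tmul_smul x y m := by
    change _ = (x ⊗ₜ 1 : EnvelopingAlgebra k A) • (1 ⊗ₜ y : EnvelopingAlgebra k A) • m
    rw [smul_smul, Algebra.TensorProduct.tmul_mul_tmul, mul_one, one_mul]

instance : SMulCommClass A Aᵐᵒᵖ (OuterBimodule k e f) where
  smul_comm x y m := by
    change (x ⊗ₜ 1 : EnvelopingAlgebra k A) • (1 ⊗ₜ y : EnvelopingAlgebra k A) • m =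
      (1 ⊗ₜ y : EnvelopingAlgebra k A) • (x ⊗ₜ 1 : EnvelopingAlgebra k A) • m
    simp only [smul_smul, Algebra.TensorProduct.tmul_mul_tmul, mul_one, one_mul]

instance : IsScalarTower k A (OuterBimodule k e f) where
  smul_assoc c x m := by
    refine (congrArg (action k e f · m) (TensorProduct.smul_tmul' c x 1).symm).trans ?_
    exact LinearMap.congr_fun (map_smul (action k e f) c (x ⊗ₜ 1)) m

variable {k e f}

theorem smul_tmul_left (x : A) (m : Submodule.span A {e}) (n : Submodule.span Aᵐᵒᵖ {f}) :
    x • tmul k e f m n = tmul k e f (x • m) n := by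
  rw [← IsBimodule.tmul_one_smul (k := k), smul_tmul, one_smul]

theorem smul_tmul_right (y : Aᵐᵒᵖ) (m : Submodule.span A {e}) (n : Submodule.span Aᵐᵒᵖ {f}) :
    y • tmul k e f m n = tmul k e f m (y • n) := by
  rw [← IsBimodule.one_tmul_smul (k := k), smul_tmul, one_smul]

variable (k e f) in
/-- The canonical generator `e ⊗ f` of the bimodule `A e ⊗ₖ f A`. -/
def gen : OuterBimodule k e f :=
  tmul k e f ⟨e, Submodule.mem_span_singleton_self e⟩ ⟨f, Submodule.mem_span_singleton_self f⟩

theorem tmul_eq_smul_gen (x y : A) (hx : x • e ∈ Submodule.span A {e})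
    (hy : op y • f ∈ Submodule.span Aᵐᵒᵖ {f}) :
    tmul k e f ⟨x • e, hx⟩ ⟨op y • f, hy⟩ = x • gen k e f <• y := by
  rw [gen, smul_tmul_right, smul_tmul_left]
  rfl

theorem tmul_induction {P : OuterBimodule k e f → Prop} (m : OuterBimodule k e f)
    (zero : P 0) (add : ∀ m m', P m → P m' → P (m + m')) (tmul : ∀ p q, P (tmul k e f p q)) :
    P m :=
  TensorProduct.induction_on m zero tmul add

theorem induction_on {P : OuterBimodule k e f → Prop} (m : OuterBimodule k e f)
    (zero : P 0) (add : ∀ m m', P m → P m' → P (m + m'))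
    (smul_gen : ∀ x y : A, P (x • gen k e f <• y)) : P m := by
  refine tmul_induction m zero add ?_
  rintro ⟨p, hp⟩ ⟨q, hq⟩
  obtain ⟨x, rfl⟩ := Submodule.mem_span_singleton.1 hp
  obtain ⟨y, rfl⟩ := Submodule.mem_span_singleton.1 hq
  exact tmul_eq_smul_gen (k := k) x y.unop hp hq ▸ smul_gen x y.unop

variable (k e f) in
theorem span_gen : Submodule.span (EnvelopingAlgebra k A) {gen k e f} = ⊤ := by
  refine Submodule.eq_top_iff'.2 fun m => ?_
  induction m using induction_on with
  | zero => exact zero_mem _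
  | add m m' hm hm' => exact add_mem hm hm'
  | smul_gen x y =>
    exact IsBimodule.tmul_smul (k := k) x (op y) (gen k e f) ▸
      Submodule.smul_mem _ _ (Submodule.mem_span_singleton_self _)

instance : Module.Finite (EnvelopingAlgebra k A) (OuterBimodule k e f) :=
  ⟨⟨{gen k e f}, by rw [Finset.coe_singleton, span_gen]⟩⟩

theorem gen_ne_zero (he : e ≠ 0) (hf : f ≠ 0) : gen k e f ≠ 0 := by
  obtain ⟨φ, hφ⟩ := Module.Projective.exists_dual_ne_zero k (Subtype.coe_ne_coe.1 he :
    (⟨e, Submodule.mem_span_singleton_self e⟩ : Submodule.span A {e}) ≠ 0)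
  obtain ⟨ψ, hψ⟩ := Module.Projective.exists_dual_ne_zero k (Subtype.coe_ne_coe.1 hf :
    (⟨f, Submodule.mem_span_singleton_self f⟩ : Submodule.span Aᵐᵒᵖ {f}) ≠ 0)
  intro h
  exact mul_ne_zero hφ hψ (congrArg (TensorProduct.dualDistrib k _ _ (φ ⊗ₜ ψ)) h)

theorem smul_gen {x : A} (hx : x * e = e) : x • gen k e f = gen k e f := by
  rw [gen, smul_tmul_left]
  exact congrArg (tmul k e f · _) (Subtype.ext hx)

theorem gen_smul {x : A} (hx : f * x = f) : gen k e f <• x = gen k e f := by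
  rw [gen, smul_tmul_right]
  exact congrArg (tmul k e f _) (Subtype.ext hx)

section lift

variable {M : Type*} [AddCommGroup M]

/-- The linear map `A e ⊗ₖ f A → M`, `p ⊗ q ↦ B p q`. -/
def liftBilin [Module k M] (B : A →ₗ[k] A →ₗ[k] M) : OuterBimodule k e f →ₗ[k] M :=
  TensorProduct.lift (B.domRestrict₁₂ ((Submodule.span A {e}).restrictScalars k)
    ((Submodule.span Aᵐᵒᵖ {f}).restrictScalars k))

theorem liftBilin_tmul [Module k M] (B : A →ₗ[k] A →ₗ[k] M) (p : Submodule.span A {e})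
    (q : Submodule.span Aᵐᵒᵖ {f}) : liftBilin B (tmul k e f p q) = B p q := rfl

variable (k e f) in
/-- The inclusion of `A e ⊗ₖ f A` into the free bimodule of rank one. -/
def toEnveloping : OuterBimodule k e f →ₗ[EnvelopingAlgebra k A] EnvelopingAlgebra k A where
  __ := liftBilin ((TensorProduct.mk k A Aᵐᵒᵖ).compl₂ (opLinearEquiv k).toLinearMap)
  map_smul' z m := by
    refine map_smul_of_forall_tmul (AddMonoidHomClass.toAddMonoidHom (liftBilin _))
      (fun x y m => ?_) z m
    simp only [AddMonoidHom.coe_coe]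
    induction m using tmul_induction with
    | zero => rw [smul_zero, map_zero, smul_zero]
    | add m m' hm hm' => rw [smul_add, map_add, hm, hm', map_add, smul_add]
    | tmul p q => exact (Algebra.TensorProduct.tmul_mul_tmul x (p : A) y (op (q : A))).symm

variable (e f) in
/-- The bimodule homomorphism sending the generator `e ⊗ f` to `e m f`. -/
def lift [Module (EnvelopingAlgebra k A) M] (m : M) :
    OuterBimodule k e f →ₗ[EnvelopingAlgebra k A] M :=
  (LinearMap.toSpanSingleton _ M m) ∘ₗ toEnveloping k e f

theorem lift_gen [Module A M] [Module Aᵐᵒᵖ M] [Module (EnvelopingAlgebra k A) M]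
    [IsBimodule k A M] (m : M) : lift e f m (gen k e f) = e • m <• f :=
  IsBimodule.tmul_smul e (op f) m

theorem projective (he : IsIdempotentElem e) (hf : IsIdempotentElem f) :
    Module.Projective (EnvelopingAlgebra k A) (OuterBimodule k e f) := by
  refine Module.Projective.of_split (toEnveloping k e f) (LinearMap.toSpanSingleton _ _ (gen k e f))
    (LinearMap.ext_on (span_gen k e f) ?_)
  rintro _ rfl
  refine (IsBimodule.tmul_smul (k := k) e (op f) (gen k e f)).trans ?_
  rw [gen_smul hf, smul_gen he, LinearMap.id_apply]

/-- The homomorphism of left modules `A e ⊗ₖ f A → M`, `p ⊗ q ↦ p • H q`. -/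
def liftLeft [Module k M] [Module A M] [IsScalarTower k A M] (H : A →ₗ[k] M) :
    OuterBimodule k e f →ₗ[A] M where
  __ := liftBilin ((Algebra.lsmul k k M).toLinearMap.compl₂ H)
  map_smul' x m := by
    simp only [AddHom.toFun_eq_coe, LinearMap.coe_toAddHom, RingHom.id_apply]
    induction m using tmul_induction with
    | zero => rw [smul_zero, map_zero, smul_zero]
    | add m m' hm hm' => rw [smul_add, map_add, hm, hm', map_add, smul_add]
    | tmul p q =>
      rw [smul_tmul_left, liftBilin_tmul, liftBilin_tmul]
      exact mul_smul x (p : A) (H q)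

theorem liftLeft_gen_smul [Module k M] [Module A M] [IsScalarTower k A M] (H : A →ₗ[k] M) (y : A) :
    liftLeft H (gen k e f <• y) = e • H (f * y) := by
  rw [gen, smul_tmul_right]; rfl

end lift

section DirectSum

variable (k : Type*) {A X : Type*} [Field k] [Ring A] [Algebra k A] [DecidableEq X] (e f : X → A)

/-- The generator `e x ⊗ f x` of the summand with index `x`. -/
def sumGen (x : X) : ⨁ x, OuterBimodule k (e x) (f x) :=
  DirectSum.of (fun x => OuterBimodule k (e x) (f x)) x (gen k (e x) (f x))

variable {k e f}

theorem smul_sumGen {x : X} {y : A} (hy : y * e x = e x) :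
    y • sumGen k e f x = sumGen k e f x := by
  rw [sumGen, ← DirectSum.lof_eq_of A, ← map_smul, smul_gen hy]

theorem sumGen_smul {x : X} {y : A} (hy : f x * y = f x) :
    sumGen k e f x <• y = sumGen k e f x := by
  rw [sumGen, ← DirectSum.lof_eq_of Aᵐᵒᵖ, ← map_smul, gen_smul hy]

theorem sumGen_ne_zero {x : X} (he : e x ≠ 0) (hf : f x ≠ 0) : sumGen k e f x ≠ 0 :=
  (map_ne_zero_iff _ (DirectSum.of_injective x)).2 (gen_ne_zero he hf)

variable {M : Type*} [AddCommGroup M]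

variable (e f) in
/-- The bimodule homomorphism sending the generator `e x ⊗ f x` to `e x • m x • f x`. -/
def sumLift [Module (EnvelopingAlgebra k A) M] (m : X → M) :
    (⨁ x, OuterBimodule k (e x) (f x)) →ₗ[EnvelopingAlgebra k A] M :=
  DirectSum.toModule _ X M fun x => lift (e x) (f x) (m x)

theorem sumLift_sumGen [Module A M] [Module Aᵐᵒᵖ M] [Module (EnvelopingAlgebra k A) M]
    [IsBimodule k A M] (m : X → M) (x : X) :
    sumLift e f m (sumGen k e f x) = e x • m x <• f x :=
  (DirectSum.toModule_lof _ x _).trans (lift_gen (m x))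

theorem range_sumLift_le [Module (EnvelopingAlgebra k A) M] {m : X → M}
    {N : Submodule (EnvelopingAlgebra k A) M} (hm : ∀ x, m x ∈ N) : (sumLift e f m).range ≤ N := by
  rintro _ ⟨z, rfl⟩
  induction z using DirectSum.induction_on with
  | zero => rw [map_zero]; exact zero_mem N
  | add z z' hz hz' => rw [map_add]; exact add_mem hz hz'
  | of x z =>
    rw [sumLift, ← DirectSum.lof_eq_of (EnvelopingAlgebra k A), DirectSum.toModule_lof]
    exact N.smul_mem _ (hm x)

variable [Module A M]

/-- The homomorphism of left modules sending `p ⊗ q` in the summand with index `x` to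
`p • H x q`. -/
def sumLiftLeft [Module k M] [IsScalarTower k A M] (H : X → A →ₗ[k] M) :
    (⨁ x, OuterBimodule k (e x) (f x)) →ₗ[A] M :=
  DirectSum.toModule A X M fun x => liftLeft (H x)

theorem sumLiftLeft_sumGen_smul [Module k M] [IsScalarTower k A M] (H : X → A →ₗ[k] M)
    (x : X) (y : A) : sumLiftLeft H (sumGen k e f x <• y) = e x • H x (f x * y) := by
  rw [sumGen, ← DirectSum.lof_eq_of Aᵐᵒᵖ, ← map_smul]
  exact (DirectSum.toModule_lof A x _).trans (liftLeft_gen_smul (H x) y)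

theorem directSum_left_ext {φ ψ : (⨁ x, OuterBimodule k (e x) (f x)) →ₗ[A] M}
    (h : ∀ (x : X) (y : A), φ (sumGen k e f x <• y) = ψ (sumGen k e f x <• y)) : φ = ψ := by
  refine DirectSum.linearMap_ext _ fun x => LinearMap.ext fun m => ?_
  induction m using induction_on with
  | zero => rw [map_zero, map_zero]
  | add m m' hm hm' => rw [map_add, map_add, hm, hm']
  | smul_gen y z =>
    have hz := h x z
    rw [sumGen, ← DirectSum.lof_eq_of Aᵐᵒᵖ, ← map_smul] at hz
    rw [map_smul _ y, map_smul _ y]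
    exact congrArg (y • ·) hz

end DirectSum

end OuterBimodule

theorem linearIndependent_of_peirce {k A V ι : Type*} [Field k] [Ring A] [Algebra k A]
    {e : V → A} (he : OrthogonalIdempotents e) {src tgt : ι → V}
    (hinj : Function.Injective fun j => (src j, tgt j)) {w : ι → A}
    (hw : ∀ j, e (src j) * w j * e (tgt j) = w j) (hw0 : ∀ j, w j ≠ 0) :
    LinearIndependent k w := by
  have peirce (j j' : ι) (hj : j' ≠ j) : e (src j) * w j' * e (tgt j) = 0 := by
    rw [← hw j']
    by_cases hs : src j = src j'
    · have ht : tgt j' ≠ tgt j := fun ht => hj (hinj (Prod.ext hs.symm ht))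
      simp only [mul_assoc, he.ortho ht, mul_zero]
    · simp only [← mul_assoc, he.ortho hs, zero_mul]
  refine linearIndependent_iff'.2 fun s c hc j hj => ?_
  have h := congrArg (e (src j) * · * e (tgt j)) hc
  simp only [Finset.mul_sum, Finset.sum_mul, mul_smul_comm, smul_mul_assoc, mul_zero,
    zero_mul] at h
  rw [Finset.sum_eq_single_of_mem j hj fun j' _ hj' => by rw [peirce j j' hj', smul_zero],
    hw] at h
  exact (smul_eq_zero.1 h).resolve_right (hw0 j)

namespace PathAlgebra

variable {k V S : Type*} [Field k] [Quiver V]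

section

variable [Fintype V]

theorem completeOrthogonalIdempotents_nil : CompleteOrthogonalIdempotents fun v : V =>
    (ofPath (Quiver.Path.nil : Quiver.Path v v) : PathAlgebra k V) where
  idem _ := ofPath_mul_ofPath .nil .nil
  ortho _ _ hvw := ofPath_mul_ofPath_of_ne .nil .nil hvw.symm
  complete := rfl

theorem map_mul_mem {B : Type*} [Ring B] [Algebra k B] (f : PathAlgebra k V →ₐ[k] B)
    {N : Submodule k B}
    (hnil : ∀ v : V, ∀ y ∈ N, f (ofPath (Quiver.Path.nil : Quiver.Path v v)) * y ∈ N)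
    (harrow : ∀ ⦃v w : V⦄ (α : v ⟶ w), ∀ y ∈ N, f (ofPath α.toPath) * y ∈ N)
    (x : PathAlgebra k V) {y : B} (hy : y ∈ N) : f x * y ∈ N := by
  induction x using induction_on with
  | h0 => rw [map_zero, zero_mul]; exact zero_mem N
  | hadd x x' hx hx' => rw [map_add, add_mul]; exact add_mem hx hx'
  | hpath r a b p =>
    rw [map_smul, smul_mul_assoc]
    refine N.smul_mem r ?_
    induction p generalizing y with
    | nil => exact hnil a y hy
    | cons p α ih =>
      have h : (ofPath (p.cons α) : PathAlgebra k V) = ofPath p * ofPath α.toPath :=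
        (ofPath_mul_ofPath p α.toPath).symm
      rw [h, map_mul, mul_assoc]
      exact ih (harrow α y hy)

end

section Representation

variable [Ring S] [Algebra k S] (φ : ∀ ⦃v w : V⦄, (v ⟶ w) → S)

/-- The product of the elements assigned to the arrows of a path. -/
def evalPath {v : V} : ∀ {w : V}, Quiver.Path v w → S
  | _, .nil => 1
  | _, .cons p α => evalPath p * φ α

theorem evalPath_comp {u v w : V} (p : Quiver.Path u v) (q : Quiver.Path v w) :
    evalPath φ (p.comp q) = evalPath φ p * evalPath φ q := by
  induction q with
  | nil => rw [Quiver.Path.comp_nil, evalPath, mul_one]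
  | cons q α ih => rw [Quiver.Path.comp_cons, evalPath, evalPath, ih, mul_assoc]

theorem evalPath_toPath {v w : V} (α : v ⟶ w) : evalPath φ α.toPath = φ α := one_mul _

variable [Fintype V] [DecidableEq V]

variable (k) in
/-- The representation of the path algebra by matrices over `S` that sends a path `v ⟶ w` to the
matrix whose only nonzero entry is the product of the elements assigned to the arrows of the path,
in position `(v, w)`. -/
def toMatrix : PathAlgebra k V →ₐ[k] Matrix V V S :=
  AlgHom.ofLinearMap (lift fun p => Matrix.single p.1 p.2.1 (evalPath φ p.2.2))
    (by
      rw [one_def, map_sum]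
      simp only [lift_ofPath, evalPath]
      exact Matrix.sum_single_one)
    (fun x y => by
      induction x using induction_on with
      | h0 => simp only [zero_mul, map_zero]
      | hadd x x' hx hx' => simp only [add_mul, map_add, hx, hx']
      | hpath r a b p =>
        induction y using induction_on with
        | h0 => simp only [mul_zero, map_zero]
        | hadd y y' hy hy' => simp only [mul_add, map_add, hy, hy']
        | hpath s c d q =>
          simp only [smul_mul_assoc, mul_smul_comm, map_smul, lift_ofPath]
          by_cases h : b = c
          · subst h
            rw [ofPath_mul_ofPath, lift_ofPath, Matrix.single_mul_single_same, evalPath_comp]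
          · rw [ofPath_mul_ofPath_of_ne p q (Ne.symm h), map_zero,
              Matrix.single_mul_single_of_ne _ _ _ _ h])

theorem toMatrix_ofPath {v w : V} (p : Quiver.Path v w) :
    toMatrix k φ (ofPath p) = Matrix.single v w (evalPath φ p) :=
  lift_ofPath _ p

end Representation

end PathAlgebra

namespace TaftAuslander

section Arrows

variable (k : Type*) [Field k] {n : ℕ} [NeZero n]

theorem completeOrthogonalIdempotents_idem :
    CompleteOrthogonalIdempotents fun x : ZMod n × ZMod n => idem k x.1 x.2 :=
  PathAlgebra.completeOrthogonalIdempotents_nil.map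
    (RingQuot.mkAlgHom k (MeshRel k n)).toRingHom

variable {k} in
theorem isIdempotentElem_idem (i u : ZMod n) : IsIdempotentElem (idem k i u) :=
  (completeOrthogonalIdempotents_idem k).idem (i, u)

/-- The arrow `a_{i,u}` as an element of `Γ`, set to zero if `u = i - 1`. -/
def arrowA (i u : ZMod n) : Gam k n :=
  if h : u ≠ i - 1 then RingQuot.mkAlgHom k (MeshRel k n) (pa k i u h) else 0

/-- The arrow `b_{i,u}` as an element of `Γ`, set to zero if `u = i`. -/
def arrowB (i u : ZMod n) : Gam k n :=
  if h : u ≠ i then RingQuot.mkAlgHom k (MeshRel k n) (pb k i u h) else 0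

theorem arrowA_of_ne {i u : ZMod n} (h : u ≠ i - 1) :
    arrowA k i u = RingQuot.mkAlgHom k (MeshRel k n) (pa k i u h) :=
  dif_pos h

theorem arrowB_of_ne {i u : ZMod n} (h : u ≠ i) :
    arrowB k i u = RingQuot.mkAlgHom k (MeshRel k n) (pb k i u h) :=
  dif_pos h

variable {k}

theorem arrowA_of_eq {i u : ZMod n} (h : u = i - 1) : arrowA k i u = 0 :=
  dif_neg (not_not_intro h)

theorem arrowB_of_eq {i u : ZMod n} (h : u = i) : arrowB k i u = 0 :=
  dif_neg (not_not_intro h)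

theorem idem_mul_arrowA (i u : ZMod n) : idem k (i - 1) u * arrowA k i u = arrowA k i u := by
  by_cases h : u = i - 1
  · rw [arrowA_of_eq h, mul_zero]
  · rw [arrowA_of_ne k h, idem, ← map_mul, pa, PathAlgebra.ofPath_mul_ofPath,
      Quiver.Path.nil_comp]

theorem arrowA_mul_idem (i u : ZMod n) : arrowA k i u * idem k i u = arrowA k i u := by
  by_cases h : u = i - 1
  · rw [arrowA_of_eq h, zero_mul]
  · rw [arrowA_of_ne k h, idem, ← map_mul, pa, PathAlgebra.ofPath_mul_ofPath,
      Quiver.Path.comp_nil]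

theorem idem_mul_arrowB (i u : ZMod n) : idem k i (u - 1) * arrowB k i u = arrowB k i u := by
  by_cases h : u = i
  · rw [arrowB_of_eq h, mul_zero]
  · rw [arrowB_of_ne k h, idem, ← map_mul, pb, PathAlgebra.ofPath_mul_ofPath,
      Quiver.Path.nil_comp]

theorem arrowB_mul_idem (i u : ZMod n) : arrowB k i u * idem k i u = arrowB k i u := by
  by_cases h : u = i
  · rw [arrowB_of_eq h, zero_mul]
  · rw [arrowB_of_ne k h, idem, ← map_mul, pb, PathAlgebra.ofPath_mul_ofPath,
      Quiver.Path.comp_nil]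

theorem mesh {i u : ZMod n} (h : u ≠ i) :
    arrowA k i (u - 1) * arrowB k i u + arrowB k (i - 1) u * arrowA k i u = 0 := by
  have ha : u - 1 ≠ i - 1 := sub_left_injective.ne h
  by_cases hu : u = i - 1
  · subst hu
    have h2 : i - 1 - 1 = i - 2 := by ring
    rw [arrowA_of_eq rfl, mul_zero, add_zero, arrowA_of_ne k ha, arrowB_of_ne k h, ← map_mul,
      ← map_zero (RingQuot.mkAlgHom k (MeshRel k n))]
    simp only [h2]
    exact RingQuot.mkAlgHom_rel k (.triangle i (h2 ▸ ha) h)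
  · rw [arrowA_of_ne k ha, arrowB_of_ne k h, arrowB_of_ne k hu, arrowA_of_ne k hu,
      ← map_mul, ← map_mul, ← map_add, ← map_zero (RingQuot.mkAlgHom k (MeshRel k n))]
    exact RingQuot.mkAlgHom_rel k (.square i u ha h hu hu)

theorem gam_mul_mem {N : Submodule k (Gam k n)}
    (hidem : ∀ i u, ∀ y ∈ N, idem k i u * y ∈ N) (hA : ∀ i u, ∀ y ∈ N, arrowA k i u * y ∈ N)
    (hB : ∀ i u, ∀ y ∈ N, arrowB k i u * y ∈ N) (x : Gam k n) {y : Gam k n} (hy : y ∈ N) :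
    x * y ∈ N := by
  obtain ⟨x, rfl⟩ := RingQuot.mkAlgHom_surjective k (MeshRel k n) x
  refine PathAlgebra.map_mul_mem _ (fun v => hidem v.1 v.2) ?_ x hy
  rintro _ _ (⟨i, u, h⟩ | ⟨i, u, h⟩) y hy
  · exact arrowA_of_ne k h ▸ hA i u y hy
  · exact arrowB_of_ne k h ▸ hB i u y hy

end Arrows

section Words

variable {n : ℕ}

/-- The length condition under which the path of `Q_n` starting at `(i, u)` and consisting of `s`
arrows `b` followed by `t` arrows `a` exists: it passes through the vertices `(i, u + s')` with
`s' ≤ s` and `(i + t', u + s)` with `t' ≤ t`. -/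
def Valid (i u : ZMod n) (s t : ℕ) : Prop :=
  (u - i).val + s < n ∧ t ≤ (u - i).val + s

theorem valid_zero_zero [NeZero n] (i u : ZMod n) : Valid i u 0 0 :=
  ⟨ZMod.val_lt _, Nat.zero_le _⟩

theorem Valid.lt_left {i u : ZMod n} {s t : ℕ} (h : Valid i u s t) : s < n :=
  (Nat.le_add_left s _).trans_lt h.1

theorem Valid.lt_right {i u : ZMod n} {s t : ℕ} (h : Valid i u s t) : t < n :=
  h.2.trans_lt h.1

theorem val_add_one_of_ne [NeZero n] {x : ZMod n} (h : x + 1 ≠ 0) :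
    (x + 1).val = x.val + 1 := by
  have hx : x + 1 = ((x.val + 1 : ℕ) : ZMod n) := by
    rw [Nat.cast_add, ZMod.natCast_zmod_val, Nat.cast_one]
  rw [hx, ZMod.val_natCast_of_lt]
  refine lt_of_le_of_ne x.val_lt fun h' => h ?_
  rw [hx, h', ZMod.natCast_self]

theorem val_add_one_of_eq [NeZero n] {x : ZMod n} (h : x + 1 = 0) : x.val + 1 = n := by
  refine le_antisymm x.val_lt (Nat.le_of_dvd (Nat.succ_pos _) ?_)
  rw [← ZMod.natCast_eq_zero_iff, Nat.cast_add, ZMod.natCast_zmod_val, Nat.cast_one, h]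

variable [NeZero n] {i u : ZMod n} {s t : ℕ}

theorem val_add_one_sub (h : u + 1 ≠ i) : (u + 1 - i).val = (u - i).val + 1 := by
  rw [add_sub_right_comm]
  exact val_add_one_of_ne (by rwa [← add_sub_right_comm, sub_ne_zero])

theorem val_sub_add_one (h : u ≠ i) : (u - (i + 1)).val + 1 = (u - i).val := by
  rw [← val_add_one_of_ne] <;> rw [← sub_sub, sub_add_cancel]
  exact sub_ne_zero.2 h

theorem valid_succ_left : Valid i u (s + 1) t ↔ u + 1 ≠ i ∧ Valid i (u + 1) s t := by
  rw [Valid, Valid]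
  by_cases h : u + 1 = i
  · have := val_add_one_of_eq (x := u - i) (by rw [← h]; ring)
    simp only [h, ne_eq, not_true_eq_false, false_and, iff_false]
    omega
  · rw [val_add_one_sub h, and_iff_right h]
    omega

theorem valid_zero_succ : Valid i u 0 (t + 1) ↔ u ≠ i ∧ Valid (i + 1) u 0 t := by
  have hlt := (u - i).val_lt
  rw [Valid, Valid]
  by_cases h : u = i
  · simp [h]
  · have := val_sub_add_one h
    rw [and_iff_right h]
    omega

end Words

section Word

variable (k : Type*) [Field k] {n : ℕ} [NeZero n]

/-- The class in `Γ` of the path starting at `(i, u)` that consists of `s` arrows `b` followed by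
`t` arrows `a`, and zero if there is no such path. -/
def word (i u : ZMod n) : ℕ → ℕ → Gam k n
  | 0, 0 => idem k i u
  | 0, t + 1 => arrowA k (i + 1) u * word (i + 1) u 0 t
  | s + 1, t => arrowB k i (u + 1) * word i (u + 1) s t

theorem word_zero_zero (i u : ZMod n) : word k i u 0 0 = idem k i u := by rw [word]

theorem word_zero_succ (i u : ZMod n) (t : ℕ) :
    word k i u 0 (t + 1) = arrowA k (i + 1) u * word k (i + 1) u 0 t := by rw [word]

theorem word_succ_left (i u : ZMod n) (s t : ℕ) :
    word k i u (s + 1) t = arrowB k i (u + 1) * word k i (u + 1) s t := by rw [word]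

variable {k}

theorem word_of_not_valid {i u : ZMod n} {s t : ℕ} (h : ¬ Valid i u s t) :
    word k i u s t = 0 := by
  induction s generalizing u with
  | zero =>
    induction t generalizing i with
    | zero => exact absurd (valid_zero_zero i u) h
    | succ t ih =>
      rw [word_zero_succ]
      by_cases hu : u = i
      · rw [arrowA_of_eq (by rw [hu, add_sub_cancel_right]), zero_mul]
      · rw [ih fun hv => h (valid_zero_succ.2 ⟨hu, hv⟩), mul_zero]
  | succ s ih =>
    rw [word_succ_left]
    by_cases hu : u + 1 = i
    · rw [arrowB_of_eq hu, zero_mul]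
    · rw [ih fun hv => h (valid_succ_left.2 ⟨hu, hv⟩), mul_zero]

theorem idem_mul_word (i u : ZMod n) (s t : ℕ) :
    idem k i u * word k i u s t = word k i u s t := by
  rcases s with - | s
  · rcases t with - | t
    · rw [word_zero_zero, (isIdempotentElem_idem i u).eq]
    · rw [word_zero_succ, ← mul_assoc, ← idem_mul_arrowA (i + 1) u, ← mul_assoc,
        add_sub_cancel_right, (isIdempotentElem_idem i u).eq]
  · rw [word_succ_left, ← mul_assoc, ← idem_mul_arrowB i (u + 1), ← mul_assoc,
      add_sub_cancel_right, (isIdempotentElem_idem i u).eq]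

theorem word_mul_idem (i u : ZMod n) (s t : ℕ) :
    word k i u s t * idem k (i + (t : ZMod n)) (u + (s : ZMod n)) = word k i u s t := by
  induction s generalizing u with
  | zero =>
    induction t generalizing i with
    | zero =>
      rw [word_zero_zero, Nat.cast_zero, add_zero, add_zero, (isIdempotentElem_idem i u).eq]
    | succ t ih =>
      rw [word_zero_succ, mul_assoc, Nat.cast_succ, add_comm (t : ZMod n), ← add_assoc, ih]
  | succ s ih =>
    rw [word_succ_left, mul_assoc, Nat.cast_succ, add_comm (s : ZMod n), ← add_assoc, ih]

theorem arrowB_mul_word (i u : ZMod n) (s t : ℕ) :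
    arrowB k i u * word k i u s t = word k i (u - 1) (s + 1) t := by
  rw [word_succ_left, sub_add_cancel]

theorem arrowA_mul_word {i u : ZMod n} (h : u ≠ i - 1) (s t : ℕ) :
    arrowA k i u * word k i u s t = (-1 : ℤ) ^ s • word k (i - 1) u s (t + 1) := by
  induction s generalizing u with
  | zero => rw [pow_zero, one_smul, word_zero_succ, sub_add_cancel]
  | succ s ih =>
    have hmesh := mesh (k := k) (show u + 1 ≠ i from fun h' => h (eq_sub_of_add_eq h'))
    rw [add_sub_cancel_right] at hmesh
    rw [word_succ_left, word_succ_left, ← mul_assoc, eq_neg_of_add_eq_zero_left hmesh, neg_mul,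
      mul_assoc]
    by_cases hu : u + 1 = i - 1
    · rw [arrowB_of_eq hu, zero_mul, zero_mul, smul_zero, neg_zero]
    · rw [ih hu, mul_smul_comm, pow_succ', neg_one_mul, neg_smul]

end Word

section Representation

variable (k : Type*) [Field k] {n : ℕ} [NeZero n]

/-- The left shift of sequences. -/
def shift : Module.End k (ℕ → k) := LinearMap.funLeft k k Nat.succ

/-- The truncation of sequences to their first `m` terms. -/
def truncate (m : ℕ) : Module.End k (ℕ → k) :=
  LinearMap.pi fun j => if j < m then LinearMap.proj j else 0

variable {k} in
theorem truncate_apply (m : ℕ) (f : ℕ → k) (j : ℕ) :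
    truncate k m f j = if j < m then f j else 0 := by
  rw [truncate, LinearMap.pi_apply]
  split_ifs <;> rfl

theorem shift_mul_truncate (m : ℕ) : shift k * truncate k (m + 1) = truncate k m * shift k := by
  ext f j
  simp only [Module.End.mul_apply, truncate_apply, shift, LinearMap.funLeft_apply,
    Nat.succ_eq_add_one, add_lt_add_iff_right]

theorem truncate_zero : truncate k 0 = 0 := by
  ext f j
  simp only [truncate_apply, Nat.not_lt_zero, if_false, LinearMap.zero_apply, Pi.zero_apply]

/-- The representation of the quiver `Q_n` on sequences in which the arrows `a` act as shifts, with
the sign that makes the squares anticommute, and the arrows `b` as truncations. -/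
def arrowAction : ∀ ⦃v w : Vertex n⦄, (v ⟶ w) → Module.End k (ℕ → k)
  | _, _, .a i u _ => (-1 : ℤ) ^ (u - i).val • shift k
  | _, _, .b i u _ => truncate k (n - (u - i).val)

instance : DecidableEq (Vertex n) := inferInstanceAs (DecidableEq (ZMod n × ZMod n))

theorem toMatrix_pa (i u : ZMod n) (h : u ≠ i - 1) :
    PathAlgebra.toMatrix k (arrowAction k) (pa k i u h) =
      Matrix.single (vtx (i - 1) u) (vtx i u) ((-1 : ℤ) ^ (u - i).val • shift k) := by
  rw [pa, PathAlgebra.toMatrix_ofPath, PathAlgebra.evalPath_toPath]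
  rfl

theorem toMatrix_pb (i u : ZMod n) (h : u ≠ i) :
    PathAlgebra.toMatrix k (arrowAction k) (pb k i u h) =
      Matrix.single (vtx i (u - 1)) (vtx i u) (truncate k (n - (u - i).val)) := by
  rw [pb, PathAlgebra.toMatrix_ofPath, PathAlgebra.evalPath_toPath]
  rfl

theorem toMatrix_eq_of_meshRel {x y : PathAlgebra k (Vertex n)} (h : MeshRel k n x y) :
    PathAlgebra.toMatrix k (arrowAction k) x = PathAlgebra.toMatrix k (arrowAction k) y := by
  rcases h with ⟨i, ha, hb⟩ | ⟨i, u, ha, hb, hb', ha'⟩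
  · have hval : n - (i - 1 - i).val = 0 + 1 := by
      have := val_add_one_of_eq (x := i - 1 - i) (by ring)
      omega
    rw [map_mul, map_zero, toMatrix_pa, toMatrix_pb, show i - 1 - 1 = i - 2 by ring,
      Matrix.single_mul_single_same, smul_mul_assoc, hval, shift_mul_truncate, truncate_zero,
      zero_mul, smul_zero, Matrix.single_zero]
  · have hval := val_add_one_sub (u := u - 1) (i := i) (by rwa [sub_add_cancel])
    have hval' := val_sub_add_one hb'
    rw [sub_add_cancel] at hval hval'
    have hn : n - (u - i).val = n - (u - (i - 1)).val + 1 := by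
      have := (u - (i - 1)).val_lt
      omega
    rw [map_add, map_mul, map_mul, map_zero, toMatrix_pa, toMatrix_pa, toMatrix_pb, toMatrix_pb,
      Matrix.single_mul_single_same, Matrix.single_mul_single_same, ← Matrix.single_add,
      smul_mul_assoc, mul_smul_comm, hn, shift_mul_truncate, ← add_smul, hval, pow_succ',
      neg_one_mul, add_neg_cancel, zero_smul, Matrix.single_zero]

/-- The representation of `Γ` by matrices that is given by `arrowAction`. -/
def rep : Gam k n →ₐ[k] Matrix (Vertex n) (Vertex n) (Module.End k (ℕ → k)) :=
  RingQuot.liftAlgHom k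
    ⟨PathAlgebra.toMatrix k (arrowAction k), fun _ _ h => toMatrix_eq_of_meshRel k h⟩

theorem rep_mkAlgHom (x : PathAlgebra k (Vertex n)) :
    rep k (RingQuot.mkAlgHom k (MeshRel k n) x) = PathAlgebra.toMatrix k (arrowAction k) x :=
  RingQuot.liftAlgHom_mkAlgHom_apply ..

variable {k}

theorem exists_rep_word_zero {i u : ZMod n} {t : ℕ} (h : Valid i u 0 t) :
    ∃ (w : Vertex n) (φ : Module.End k (ℕ → k)) (m : ℕ),
      rep k (word k i u 0 t) = Matrix.single (vtx i u) w φ ∧ φ 1 = (-1 : ℤ) ^ m • 1 := by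
  induction t generalizing i with
  | zero =>
    refine ⟨vtx i u, 1, 0, ?_, (one_smul _ _).symm⟩
    rw [word_zero_zero, idem, rep_mkAlgHom, PathAlgebra.toMatrix_ofPath, PathAlgebra.evalPath]
  | succ t ih =>
    obtain ⟨hu, hv⟩ := valid_zero_succ.1 h
    obtain ⟨w, φ, m, hφ, hm⟩ := ih hv
    refine ⟨w, (-1 : ℤ) ^ (u - (i + 1)).val • shift k * φ, m + (u - (i + 1)).val, ?_, ?_⟩
    · rw [word_zero_succ, arrowA_of_ne k (by rwa [add_sub_cancel_right]), map_mul, hφ,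
        rep_mkAlgHom, toMatrix_pa, add_sub_cancel_right, Matrix.single_mul_single_same]
    · rw [Module.End.mul_apply, hm, map_zsmul, pow_add, mul_smul]
      rfl

theorem exists_rep_word {i u : ZMod n} {s t : ℕ} (h : Valid i u s t) :
    ∃ (w : Vertex n) (φ : Module.End k (ℕ → k)),
      rep k (word k i u s t) = Matrix.single (vtx i u) w φ ∧ φ 1 0 ≠ 0 := by
  induction s generalizing u with
  | zero =>
    obtain ⟨w, φ, m, hφ, hm⟩ := exists_rep_word_zero (k := k) h
    refine ⟨w, φ, hφ, ?_⟩
    rw [hm]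
    rcases neg_one_pow_eq_or ℤ m with h | h <;> simp [h]
  | succ s ih =>
    obtain ⟨hu, hv⟩ := valid_succ_left.1 h
    obtain ⟨w, φ, hφ, h0⟩ := ih hv
    refine ⟨w, truncate k (n - (u + 1 - i).val) * φ, ?_, ?_⟩
    · rw [word_succ_left, arrowB_of_ne k hu, map_mul, hφ, rep_mkAlgHom, toMatrix_pb,
        add_sub_cancel_right, Matrix.single_mul_single_same]
    · rwa [Module.End.mul_apply, truncate_apply, if_pos (Nat.sub_pos_of_lt (ZMod.val_lt _))]

theorem word_ne_zero {i u : ZMod n} {s t : ℕ} (h : Valid i u s t) : word k i u s t ≠ 0 := by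
  obtain ⟨w, φ, hφ, h0⟩ := exists_rep_word (k := k) h
  intro h'
  rw [h', map_zero] at hφ
  have hφ0 : φ = 0 := by rw [← Matrix.single_apply_same (vtx i u) w φ, ← hφ, Matrix.zero_apply]
  rw [hφ0] at h0
  exact h0 rfl

end Representation

section Filtration

variable (k : Type*) [Field k] (n : ℕ) [NeZero n]

/-- The span of the words of length at least `m`; this is the `m`-th power of the radical
of `Γ`. -/
def radPow (m : ℕ) : Submodule k (Gam k n) :=
  Submodule.span k {w | ∃ (i u : ZMod n) (s t : ℕ), m ≤ s + t ∧ word k i u s t = w}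

variable {k n}

theorem word_mem_radPow {m s t : ℕ} (i u : ZMod n) (h : m ≤ s + t) :
    word k i u s t ∈ radPow k n m :=
  Submodule.subset_span ⟨i, u, s, t, h, rfl⟩

theorem radPow_antitone : Antitone (radPow k n) := fun _ _ hm =>
  Submodule.span_mono fun _ ⟨i, u, s, t, h, hw⟩ => ⟨i, u, s, t, hm.trans h, hw⟩

theorem mul_word_of_ne {i u i' u' : ZMod n} {s t : ℕ} {x : Gam k n}
    (hx : x * idem k i u = x) (h : (i, u) ≠ (i', u')) : x * word k i' u' s t = 0 := by
  rw [← hx, ← idem_mul_word, mul_assoc, ← mul_assoc (idem k i u),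
    (completeOrthogonalIdempotents_idem k).ortho h, zero_mul, mul_zero]

theorem mul_mem_radPow {i u : ZMod n} {m m' : ℕ} {x y : Gam k n} (hx : x * idem k i u = x)
    (hword : ∀ s t, m ≤ s + t → x * word k i u s t ∈ radPow k n m') (hy : y ∈ radPow k n m) :
    x * y ∈ radPow k n m' := by
  suffices h : radPow k n m ≤ (radPow k n m').comap (LinearMap.mulLeft k x) from h hy
  refine Submodule.span_le.2 ?_
  rintro _ ⟨i', u', s, t, hst, rfl⟩
  by_cases h : (i, u) = (i', u')
  · obtain ⟨rfl, rfl⟩ := Prod.mk.inj h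
    exact hword s t hst
  · rw [SetLike.mem_coe, Submodule.mem_comap, LinearMap.mulLeft_apply, mul_word_of_ne hx h]
    exact zero_mem _

theorem idem_mul_mem_radPow (i u : ZMod n) {m : ℕ} {y : Gam k n} (hy : y ∈ radPow k n m) :
    idem k i u * y ∈ radPow k n m :=
  mul_mem_radPow (isIdempotentElem_idem i u)
    (fun s t h => by rw [idem_mul_word]; exact word_mem_radPow i u h) hy

theorem arrowA_mul_mem_radPow (i u : ZMod n) {m : ℕ} {y : Gam k n} (hy : y ∈ radPow k n m) :
    arrowA k i u * y ∈ radPow k n (m + 1) := by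
  refine mul_mem_radPow (arrowA_mul_idem i u) (fun s t h => ?_) hy
  by_cases hu : u = i - 1
  · rw [arrowA_of_eq hu, zero_mul]
    exact zero_mem _
  · rw [arrowA_mul_word hu]
    exact zsmul_mem (word_mem_radPow _ _ (by omega)) _

theorem arrowB_mul_mem_radPow (i u : ZMod n) {m : ℕ} {y : Gam k n} (hy : y ∈ radPow k n m) :
    arrowB k i u * y ∈ radPow k n (m + 1) := by
  refine mul_mem_radPow (arrowB_mul_idem i u) (fun s t h => ?_) hy
  rw [arrowB_mul_word]
  exact word_mem_radPow _ _ (by omega)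

theorem mul_mem_radPow_of_mem {m : ℕ} (x : Gam k n) {y : Gam k n} (hy : y ∈ radPow k n m) :
    x * y ∈ radPow k n m :=
  gam_mul_mem (fun i u _ => idem_mul_mem_radPow i u)
    (fun i u _ hy => radPow_antitone m.le_succ (arrowA_mul_mem_radPow i u hy))
    (fun i u _ hy => radPow_antitone m.le_succ (arrowB_mul_mem_radPow i u hy)) x hy

theorem radPow_zero : radPow k n 0 = ⊤ := by
  have h1 : (1 : Gam k n) ∈ radPow k n 0 := by
    rw [← (completeOrthogonalIdempotents_idem k).complete]
    exact sum_mem fun x _ => word_zero_zero k x.1 x.2 ▸ word_mem_radPow x.1 x.2 le_rfl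
  exact Submodule.eq_top_iff'.2 fun x => mul_one x ▸ mul_mem_radPow_of_mem x h1

theorem word_mul_mem_radPow (i u : ZMod n) (s t : ℕ) {m : ℕ} {y : Gam k n}
    (hy : y ∈ radPow k n m) : word k i u s t * y ∈ radPow k n (m + (s + t)) := by
  induction s generalizing u with
  | zero =>
    induction t generalizing i with
    | zero => exact word_zero_zero k i u ▸ idem_mul_mem_radPow i u hy
    | succ t ih =>
      rw [word_zero_succ, mul_assoc]
      exact arrowA_mul_mem_radPow _ _ (ih (i + 1))
  | succ s ih =>
    rw [word_succ_left, mul_assoc, add_right_comm, ← add_assoc]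
    exact arrowB_mul_mem_radPow _ _ (ih (u + 1))

theorem radPow_mul_le (m m' : ℕ) : radPow k n m * radPow k n m' ≤ radPow k n (m + m') := by
  refine Submodule.mul_le.2 fun x hx y hy => ?_
  suffices h : radPow k n m ≤ (radPow k n (m + m')).comap (LinearMap.mulRight k y) from h hx
  refine Submodule.span_le.2 ?_
  rintro _ ⟨i, u, s, t, hst, rfl⟩
  exact radPow_antitone (by omega) (word_mul_mem_radPow i u s t hy)

theorem radPow_one_pow_le (m : ℕ) : radPow k n 1 ^ m ≤ radPow k n m := by
  induction m with
  | zero => rw [radPow_zero]; exact le_top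
  | succ m ih =>
    rw [pow_succ]
    exact (mul_le_mul' ih le_rfl).trans (radPow_mul_le m 1)

theorem radPow_two_mul : radPow k n (2 * n) = ⊥ := by
  refine Submodule.span_eq_bot.2 ?_
  rintro _ ⟨i, u, s, t, h, rfl⟩
  refine word_of_not_valid fun hv => ?_
  have := hv.lt_left
  have := hv.lt_right
  omega

theorem radPow_one_pow : radPow k n 1 ^ (2 * n) = ⊥ :=
  le_bot_iff.1 ((radPow_one_pow_le _).trans radPow_two_mul.le)

theorem radPow_one_mul_top_le : radPow k n 1 * ⊤ ≤ radPow k n 1 := by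
  rw [← radPow_zero]
  exact radPow_mul_le 1 0

theorem top_mul_radPow_one_le : ⊤ * radPow k n 1 ≤ radPow k n 1 :=
  Submodule.mul_le.2 fun x _ _ hy => mul_mem_radPow_of_mem x hy

theorem arrowA_mem_radPow_one (i u : ZMod n) : arrowA k i u ∈ radPow k n 1 := by
  have h1 : (1 : Gam k n) ∈ radPow k n 0 := by rw [radPow_zero]; trivial
  exact mul_one (arrowA k i u) ▸ arrowA_mul_mem_radPow i u h1

theorem arrowB_mem_radPow_one (i u : ZMod n) : arrowB k i u ∈ radPow k n 1 := by
  have h1 : (1 : Gam k n) ∈ radPow k n 0 := by rw [radPow_zero]; trivial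
  exact mul_one (arrowB k i u) ▸ arrowB_mul_mem_radPow i u h1

end Filtration

section Basis

/-- The index set of the basis of `Γ` formed by the nonzero words. -/
abbrev ValidIndex (n : ℕ) :=
  {j : (ZMod n × ZMod n) × ℕ × ℕ // Valid j.1.1 j.1.2 j.2.1 j.2.2}

theorem ValidIndex.src_tgt_injective {n : ℕ} : Function.Injective fun j : ValidIndex n =>
    (j.1.1, j.1.1 + ((j.1.2.2 : ZMod n), (j.1.2.1 : ZMod n))) := by
  rintro ⟨⟨x, s, t⟩, h⟩ ⟨⟨x', s', t'⟩, h'⟩ heq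
  obtain ⟨rfl, heq⟩ := Prod.mk.inj heq
  obtain ⟨ht, hs⟩ := Prod.mk.inj (add_left_cancel heq)
  rw [ZMod.natCast_eq_natCast_iff] at ht hs
  obtain rfl := Nat.ModEq.eq_of_lt_of_lt ht h.lt_right h'.lt_right
  obtain rfl := Nat.ModEq.eq_of_lt_of_lt hs h.lt_left h'.lt_left
  rfl

variable (k : Type*) [Field k] (n : ℕ) [NeZero n]

/-- The basis of `Γ` formed by the nonzero words. -/
def wordBasis : Module.Basis (ValidIndex n) k (Gam k n) :=
  .mk (v := fun j => word k j.1.1.1 j.1.1.2 j.1.2.1 j.1.2.2)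
    (linearIndependent_of_peirce
      (completeOrthogonalIdempotents_idem k).toOrthogonalIdempotents ValidIndex.src_tgt_injective
      (fun j => by
        rw [idem_mul_word]
        exact word_mul_idem ..)
      fun j => word_ne_zero j.2)
    (by
      rw [← radPow_zero]
      refine Submodule.span_le.2 ?_
      rintro _ ⟨i, u, s, t, -, rfl⟩
      by_cases h : Valid i u s t
      · exact Submodule.subset_span ⟨⟨((i, u), s, t), h⟩, rfl⟩
      · rw [word_of_not_valid h]
        exact zero_mem _)

variable {k n} in
theorem wordBasis_apply {i u : ZMod n} {s t : ℕ} (h : Valid i u s t) :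
    wordBasis k n ⟨((i, u), s, t), h⟩ = word k i u s t :=
  Module.Basis.mk_apply ..

end Basis

section Complex

variable (k : Type*) [Field k] {n : ℕ} [NeZero n]

/-- The generator `e_{i,u} ⊗ e_{i,u}` of `R₀`. -/
def gen₀ (i u : ZMod n) : R₀ k n :=
  OuterBimodule.sumGen k (fun x : ZMod n × ZMod n => idem k x.1 x.2) (fun x => idem k x.1 x.2)
    (i, u)

/-- The generator `e_{i-1,u} ⊗ e_{i,u}` of the summand of `R₁` corresponding to the arrow
`a_{i,u}`, set to zero if `u = i - 1`. -/
def genA (i u : ZMod n) : R₁ k n :=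
  if h : u ≠ i - 1 then
    (OuterBimodule.sumGen k
      (fun x : {x : ZMod n × ZMod n // x.2 ≠ x.1 - 1} => idem k (x.1.1 - 1) x.1.2)
      (fun x => idem k x.1.1 x.1.2) ⟨(i, u), h⟩, 0)
  else 0

/-- The generator `e_{i,u-1} ⊗ e_{i,u}` of the summand of `R₁` corresponding to the arrow
`b_{i,u}`, set to zero if `u = i`. -/
def genB (i u : ZMod n) : R₁ k n :=
  if h : u ≠ i then
    (0, OuterBimodule.sumGen k
      (fun x : {x : ZMod n × ZMod n // x.2 ≠ x.1} => idem k x.1.1 (x.1.2 - 1))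
      (fun x => idem k x.1.1 x.1.2) ⟨(i, u), h⟩)
  else 0

/-- The generator `e_{i-1,u-1} ⊗ e_{i,u}` of `R₂`, set to zero if `u = i`. -/
def gen₂ (i u : ZMod n) : R₂ k n :=
  if h : i ≠ u then
    OuterBimodule.sumGen k
      (fun x : {x : ZMod n × ZMod n // x.1 ≠ x.2} => idem k (x.1.1 - 1) (x.1.2 - 1))
      (fun x => idem k x.1.1 x.1.2) ⟨(i, u), h⟩
  else 0

theorem genA_of_eq {i u : ZMod n} (h : u = i - 1) : genA k i u = 0 :=
  dif_neg (not_not_intro h)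

theorem genB_of_eq {i u : ZMod n} (h : u = i) : genB k i u = 0 :=
  dif_neg (not_not_intro h)

variable {k}

theorem idem_smul_gen₀ (i u : ZMod n) : idem k i u • gen₀ k i u = gen₀ k i u := by
  rw [gen₀]
  exact OuterBimodule.smul_sumGen (isIdempotentElem_idem i u)

theorem gen₀_smul_idem (i u : ZMod n) : gen₀ k i u <• idem k i u = gen₀ k i u := by
  rw [gen₀]
  exact OuterBimodule.sumGen_smul (isIdempotentElem_idem i u)

theorem idem_smul_genA (i u : ZMod n) : idem k (i - 1) u • genA k i u = genA k i u := by
  rw [genA]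
  split_ifs
  · exact Prod.ext (OuterBimodule.smul_sumGen (isIdempotentElem_idem _ _)) (smul_zero _)
  · exact smul_zero _

theorem genA_smul_idem (i u : ZMod n) : genA k i u <• idem k i u = genA k i u := by
  rw [genA]
  split_ifs
  · exact Prod.ext (OuterBimodule.sumGen_smul (isIdempotentElem_idem _ _)) (smul_zero _)
  · exact smul_zero _

theorem idem_smul_genB (i u : ZMod n) : idem k i (u - 1) • genB k i u = genB k i u := by
  rw [genB]
  split_ifs
  · exact Prod.ext (smul_zero _) (OuterBimodule.smul_sumGen (isIdempotentElem_idem _ _))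
  · exact smul_zero _

theorem genB_smul_idem (i u : ZMod n) : genB k i u <• idem k i u = genB k i u := by
  rw [genB]
  split_ifs
  · exact Prod.ext (smul_zero _) (OuterBimodule.sumGen_smul (isIdempotentElem_idem _ _))
  · exact smul_zero _

theorem idem_smul_gen₂ (i u : ZMod n) : idem k (i - 1) (u - 1) • gen₂ k i u = gen₂ k i u := by
  rw [gen₂]
  split_ifs
  · exact OuterBimodule.smul_sumGen (isIdempotentElem_idem _ _)
  · exact smul_zero _

/-- The image under `d₁` of the generator belonging to an arrow `x : (i, u) → (i', u')`. -/
def arrowBoundary (i u i' u' : ZMod n) (x : Gam k n) : R₀ k n :=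
  gen₀ k i u <• x - x • gen₀ k i' u'

theorem boundary_mul {A M : Type*} [Ring A] [AddCommGroup M] [Module A M] [Module Aᵐᵒᵖ M]
    [SMulCommClass A Aᵐᵒᵖ M] (x y : A) (m m' m'' : M) :
    (m <• x - x • m') <• y + x • (m' <• y - y • m'') = m <• (x * y) - (x * y) • m'' := by
  rw [smul_sub, smul_sub, op_smul_op_smul, smul_smul, smul_comm x, sub_add_sub_cancel]

variable (k) in
/-- The image under `d₂` of the generator belonging to a mesh: the mesh relation with one of its
arrows replaced by the corresponding generator of `R₁` in all possible ways. -/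
def meshBoundary (i u : ZMod n) : R₁ k n :=
  genA k i (u - 1) <• arrowB k i u + arrowA k i (u - 1) • genB k i u +
    genB k (i - 1) u <• arrowA k i u + arrowB k (i - 1) u • genA k i u

variable (k n)

/-- The augmentation of the resolution, which multiplies the tensor factors. -/
def ε : R₀ k n →ₗ[EnvelopingAlgebra k (Gam k n)] Gam k n :=
  OuterBimodule.sumLift _ _ fun _ => 1

/-- The first differential of the resolution. -/
def d₁ : R₁ k n →ₗ[EnvelopingAlgebra k (Gam k n)] R₀ k n :=
  LinearMap.coprod
    (OuterBimodule.sumLift _ _ fun x =>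
      arrowBoundary (x.1.1 - 1) x.1.2 x.1.1 x.1.2 (arrowA k x.1.1 x.1.2))
    (OuterBimodule.sumLift _ _ fun x =>
      arrowBoundary x.1.1 (x.1.2 - 1) x.1.1 x.1.2 (arrowB k x.1.1 x.1.2))

/-- The second differential of the resolution. -/
def d₂ : R₂ k n →ₗ[EnvelopingAlgebra k (Gam k n)] R₁ k n :=
  OuterBimodule.sumLift _ _ fun x => meshBoundary k x.1.1 x.1.2

variable {k n}

theorem ε_gen₀ (i u : ZMod n) : ε k n (gen₀ k i u) = idem k i u := by
  refine (OuterBimodule.sumLift_sumGen _ _).trans ?_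
  rw [op_smul_eq_mul, one_mul, smul_eq_mul, (isIdempotentElem_idem i u).eq]

theorem smul_arrowBoundary_smul {i u i' u' : ZMod n} {x : Gam k n} (hx : idem k i u * x = x)
    (hx' : x * idem k i' u' = x) :
    idem k i u • arrowBoundary i u i' u' x <• idem k i' u' = arrowBoundary i u i' u' x := by
  rw [arrowBoundary, smul_sub, smul_sub, op_smul_op_smul, hx', smul_comm, idem_smul_gen₀,
    ← smul_comm x, gen₀_smul_idem, smul_smul, hx]

theorem d₁_genA (i u : ZMod n) :
    d₁ k n (genA k i u) = gen₀ k (i - 1) u <• arrowA k i u - arrowA k i u • gen₀ k i u := by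
  by_cases h : u = i - 1
  · rw [genA_of_eq k h, arrowA_of_eq h, map_zero, op_zero, zero_smul, zero_smul, sub_zero]
  · rw [genA, dif_pos h, d₁, LinearMap.coprod_apply, map_zero, add_zero]
    exact (OuterBimodule.sumLift_sumGen _ _).trans
      (smul_arrowBoundary_smul (idem_mul_arrowA i u) (arrowA_mul_idem i u))

theorem d₁_genB (i u : ZMod n) :
    d₁ k n (genB k i u) = gen₀ k i (u - 1) <• arrowB k i u - arrowB k i u • gen₀ k i u := by
  by_cases h : u = i
  · rw [genB_of_eq k h, arrowB_of_eq h, map_zero, op_zero, zero_smul, zero_smul, sub_zero]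
  · rw [genB, dif_pos h, d₁, LinearMap.coprod_apply, map_zero, zero_add]
    exact (OuterBimodule.sumLift_sumGen _ _).trans
      (smul_arrowBoundary_smul (idem_mul_arrowB i u) (arrowB_mul_idem i u))

theorem idem_smul_meshBoundary (i u : ZMod n) :
    idem k (i - 1) (u - 1) • meshBoundary k i u = meshBoundary k i u := by
  simp only [meshBoundary, smul_add, smul_smul, idem_mul_arrowA, idem_mul_arrowB,
    smul_comm _ (op _), idem_smul_genA, idem_smul_genB]

theorem meshBoundary_smul_idem (i u : ZMod n) :
    meshBoundary k i u <• idem k i u = meshBoundary k i u := by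
  simp only [meshBoundary, smul_add, op_smul_op_smul, arrowA_mul_idem, arrowB_mul_idem,
    ← smul_comm (arrowA k _ _), ← smul_comm (arrowB k _ _), genA_smul_idem, genB_smul_idem]

theorem d₂_gen₂ {i u : ZMod n} (h : u ≠ i) : d₂ k n (gen₂ k i u) = meshBoundary k i u := by
  rw [gen₂, dif_pos h.symm]
  refine (OuterBimodule.sumLift_sumGen _ _).trans ?_
  rw [meshBoundary_smul_idem, idem_smul_meshBoundary]

end Complex

section Extensionality

variable {k : Type*} [Field k] {n : ℕ} [NeZero n] {M : Type*} [AddCommGroup M]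
  [Module (Gam k n) M] [Module k M] [IsScalarTower k (Gam k n) M]

theorem sumGen_word_ext {X : Type*} [DecidableEq X] {e : X → Gam k n} {i u : X → ZMod n}
    {φ ψ : (⨁ x, OuterBimodule k (e x) (idem k (i x) (u x))) →ₗ[Gam k n] M}
    (h : ∀ x s t,
      φ (OuterBimodule.sumGen k e (fun x => idem k (i x) (u x)) x <• word k (i x) (u x) s t) =
      ψ (OuterBimodule.sumGen k e (fun x => idem k (i x) (u x)) x <• word k (i x) (u x) s t)) :
    φ = ψ := by
  refine OuterBimodule.directSum_left_ext fun x y => ?_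
  have hy : y ∈ radPow k n 0 := radPow_zero (k := k) (n := n) ▸ Submodule.mem_top
  induction hy using Submodule.span_induction with
  | zero => rw [op_zero, zero_smul, map_zero, map_zero]
  | add y y' _ _ hy hy' => rw [op_add, add_smul, map_add, map_add, hy, hy']
  | smul c y _ hy =>
    rw [IsBimodule.smul_op_smul, φ.map_smul_of_tower, ψ.map_smul_of_tower, hy]
  | mem y hy =>
    obtain ⟨i', u', s, t, -, rfl⟩ := hy
    by_cases hx : (i x, u x) = (i', u')
    · obtain ⟨rfl, rfl⟩ := Prod.mk.inj hx
      exact h x s t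
    · have hgen : OuterBimodule.sumGen k e (fun x => idem k (i x) (u x)) x <• idem k (i x) (u x) =
          OuterBimodule.sumGen k e (fun x => idem k (i x) (u x)) x :=
        OuterBimodule.sumGen_smul (isIdempotentElem_idem _ _)
      rw [← hgen, op_smul_op_smul, mul_word_of_ne (isIdempotentElem_idem _ _) hx, op_zero,
        zero_smul, map_zero, map_zero]

theorem R₀_word_ext {φ ψ : R₀ k n →ₗ[Gam k n] M}
    (h : ∀ i u s t, φ (gen₀ k i u <• word k i u s t) = ψ (gen₀ k i u <• word k i u s t)) :
    φ = ψ :=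
  sumGen_word_ext fun x => h x.1 x.2

theorem R₁_word_ext {φ ψ : R₁ k n →ₗ[Gam k n] M}
    (hA : ∀ i u, u ≠ i - 1 → ∀ s t,
      φ (genA k i u <• word k i u s t) = ψ (genA k i u <• word k i u s t))
    (hB : ∀ i u, u ≠ i → ∀ s t,
      φ (genB k i u <• word k i u s t) = ψ (genB k i u <• word k i u s t)) :
    φ = ψ := by
  refine LinearMap.prod_ext (sumGen_word_ext fun x s t => ?_) (sumGen_word_ext fun x s t => ?_)
  · have h := hA x.1.1 x.1.2 x.2 s t
    rw [genA, dif_pos x.2, Prod.smul_mk, smul_zero] at h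
    exact h
  · have h := hB x.1.1 x.1.2 x.2 s t
    rw [genB, dif_pos x.2, Prod.smul_mk, smul_zero] at h
    exact h

theorem R₂_word_ext {φ ψ : R₂ k n →ₗ[Gam k n] M}
    (h : ∀ i u, u ≠ i → ∀ s t,
      φ (gen₂ k i u <• word k i u s t) = ψ (gen₂ k i u <• word k i u s t)) :
    φ = ψ := by
  refine sumGen_word_ext fun x s t => ?_
  have h := h x.1.1 x.1.2 x.2.symm s t
  rw [gen₂, dif_pos x.2] at h
  exact h

end Extensionality

section Derivatives

variable (k : Type*) [Field k] {n : ℕ} [NeZero n]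

variable (n) in
/-- The sum of the generators of `R₀`; it is a preimage of `1` under `ε`. -/
def unitGen : R₀ k n := ∑ x : ZMod n × ZMod n, gen₀ k x.1 x.2

/-- The noncommutative derivative of a word: the sum, over all factorizations `p * x * q` of the
word with an arrow `x`, of `p • g <• q`, where `g` is the generator of `R₁` belonging to `x`. -/
def wordDeriv (i u : ZMod n) : ℕ → ℕ → R₁ k n
  | 0, 0 => 0
  | 0, t + 1 => genA k (i + 1) u <• word k (i + 1) u 0 t +
      arrowA k (i + 1) u • wordDeriv (i + 1) u 0 t
  | s + 1, t => genB k i (u + 1) <• word k i (u + 1) s t +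
      arrowB k i (u + 1) • wordDeriv i (u + 1) s t

/-- The element of `R₂` recording the meshes over which the arrow `a_{i,u}` is moved when the
product of `a_{i,u}` and a word starting at `(i, u)` is rewritten as a multiple of a word. -/
def meshDeriv (i u : ZMod n) : ℕ → ℕ → R₂ k n
  | 0, _ => 0
  | s + 1, t => gen₂ k i (u + 1) <• word k i (u + 1) s t -
      arrowB k (i - 1) (u + 1) • meshDeriv i (u + 1) s t

variable {k}

theorem idem_smul_unitGen (i u : ZMod n) : idem k i u • unitGen k n = gen₀ k i u := by
  rw [unitGen, Finset.smul_sum, Fintype.sum_eq_single (i, u), idem_smul_gen₀]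
  intro x hx
  have hortho : idem k i u * idem k x.1 x.2 = 0 :=
    (completeOrthogonalIdempotents_idem k).ortho hx.symm
  rw [← idem_smul_gen₀, smul_smul, hortho, zero_smul]

theorem ε_unitGen : ε k n (unitGen k n) = 1 := by
  rw [unitGen, map_sum, ← (completeOrthogonalIdempotents_idem k).complete]
  exact Fintype.sum_congr _ _ fun x => ε_gen₀ x.1 x.2

theorem wordDeriv_of_not_valid {i u : ZMod n} {s t : ℕ} (h : ¬ Valid i u s t) :
    wordDeriv k i u s t = 0 := by
  induction s generalizing u with
  | zero =>
    induction t generalizing i with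
    | zero => exact absurd (valid_zero_zero i u) h
    | succ t ih =>
      rw [wordDeriv]
      by_cases hu : u = i
      · have hu' : u = i + 1 - 1 := by rw [hu, add_sub_cancel_right]
        rw [genA_of_eq k hu', arrowA_of_eq hu', smul_zero, zero_smul, add_zero]
      · have hv : ¬ Valid (i + 1) u 0 t := fun hv => h (valid_zero_succ.2 ⟨hu, hv⟩)
        rw [ih hv, word_of_not_valid hv, op_zero, zero_smul, smul_zero, add_zero]
  | succ s ih =>
    rw [wordDeriv]
    by_cases hu : u + 1 = i
    · rw [genB_of_eq k hu, arrowB_of_eq hu, smul_zero, zero_smul, add_zero]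
    · have hv : ¬ Valid i (u + 1) s t := fun hv => h (valid_succ_left.2 ⟨hu, hv⟩)
      rw [ih hv, word_of_not_valid hv, op_zero, zero_smul, smul_zero, add_zero]

theorem idem_smul_wordDeriv (i u : ZMod n) (s t : ℕ) :
    idem k i u • wordDeriv k i u s t = wordDeriv k i u s t := by
  rcases s with - | s
  · rcases t with - | t
    · rw [wordDeriv, smul_zero]
    · have hA := idem_smul_genA (k := k) (i + 1) u
      have ha := idem_mul_arrowA (k := k) (i + 1) u
      rw [add_sub_cancel_right] at hA ha
      rw [wordDeriv, smul_add, smul_comm, hA, smul_smul, ha]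
  · have hB := idem_smul_genB (k := k) i (u + 1)
    have hb := idem_mul_arrowB (k := k) i (u + 1)
    rw [add_sub_cancel_right] at hB hb
    rw [wordDeriv, smul_add, smul_comm, hB, smul_smul, hb]

theorem idem_smul_meshDeriv (i u : ZMod n) (s t : ℕ) :
    idem k (i - 1) u • meshDeriv k i u s t = meshDeriv k i u s t := by
  rcases s with - | s
  · rw [meshDeriv, smul_zero]
  · have hg := idem_smul_gen₂ (k := k) i (u + 1)
    have hb := idem_mul_arrowB (k := k) (i - 1) (u + 1)
    rw [add_sub_cancel_right] at hg hb
    rw [meshDeriv, smul_sub, smul_comm, hg, smul_smul, hb]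

theorem d₁_wordDeriv (i u : ZMod n) (s t : ℕ) :
    d₁ k n (wordDeriv k i u s t) =
      gen₀ k i u <• word k i u s t - word k i u s t • unitGen k n := by
  induction s generalizing u with
  | zero =>
    induction t generalizing i with
    | zero =>
      rw [wordDeriv, word_zero_zero, idem_smul_unitGen, gen₀_smul_idem, map_zero, sub_self]
    | succ t ih =>
      rw [wordDeriv, map_add, IsBimodule.map_smul_right, IsBimodule.map_smul_left, ih, d₁_genA,
        boundary_mul, word_zero_succ, add_sub_cancel_right]
  | succ s ih =>
    rw [wordDeriv, map_add, IsBimodule.map_smul_right, IsBimodule.map_smul_left, ih, d₁_genB,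
      boundary_mul, word_succ_left, add_sub_cancel_right]

theorem meshDeriv_of_not_valid {i u : ZMod n} {s t : ℕ} (hu : u ≠ i - 1) (h : ¬ Valid i u s t) :
    meshDeriv k i u s t = 0 := by
  induction s generalizing u with
  | zero => rw [meshDeriv]
  | succ s ih =>
    have hv : ¬ Valid i (u + 1) s t := fun hv =>
      h (valid_succ_left.2 ⟨mt eq_sub_of_add_eq hu, hv⟩)
    rw [meshDeriv, word_of_not_valid hv, op_zero, zero_smul, zero_sub, neg_eq_zero]
    by_cases hu' : u + 1 = i - 1
    · rw [arrowB_of_eq hu', zero_smul]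
    · rw [ih hu' hv, smul_zero]

theorem genB_smul_arrowA_mul_word (i u : ZMod n) (s t : ℕ) :
    genB k (i - 1) u <• (arrowA k i u * word k i u s t) =
      (-1 : ℤ) ^ s • (genB k (i - 1) u <• word k (i - 1) u s (t + 1)) := by
  by_cases h : u = i - 1
  · rw [genB_of_eq k h, smul_zero, smul_zero, smul_zero]
  · rw [arrowA_mul_word h, op_smul, smul_assoc]

theorem d₂_meshDeriv {i u : ZMod n} (h : u ≠ i - 1) (s t : ℕ) :
    d₂ k n (meshDeriv k i u s t) =
      genA k i u <• word k i u s t + arrowA k i u • wordDeriv k i u s t -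
        (-1 : ℤ) ^ s • wordDeriv k (i - 1) u s (t + 1) := by
  induction s generalizing u with
  | zero =>
    rw [meshDeriv, map_zero, pow_zero, one_smul, wordDeriv.eq_def k (i - 1)]
    simp only [sub_add_cancel, sub_self]
  | succ s ih =>
    have hu : u + 1 ≠ i := mt eq_sub_of_add_eq h
    have ih' : arrowB k (i - 1) (u + 1) • d₂ k n (meshDeriv k i (u + 1) s t) =
        arrowB k (i - 1) (u + 1) • (genA k i (u + 1) <• word k i (u + 1) s t +
          arrowA k i (u + 1) • wordDeriv k i (u + 1) s t -
          (-1 : ℤ) ^ s • wordDeriv k (i - 1) (u + 1) s (t + 1)) := by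
      by_cases hu' : u + 1 = i - 1
      · rw [arrowB_of_eq hu', zero_smul, zero_smul]
      · rw [ih hu']
    have hmesh : arrowB k (i - 1) (u + 1) • arrowA k i (u + 1) • wordDeriv k i (u + 1) s t =
        -(arrowA k i u • arrowB k i (u + 1) • wordDeriv k i (u + 1) s t) := by
      have := mesh (k := k) hu
      rw [add_sub_cancel_right] at this
      rw [smul_smul, smul_smul, ← neg_smul, eq_neg_of_add_eq_zero_right this]
    rw [meshDeriv, map_sub, IsBimodule.map_smul_right, IsBimodule.map_smul_left, ih', d₂_gen₂ hu,
      meshBoundary, add_sub_cancel_right, wordDeriv, wordDeriv, word_succ_left]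
    simp only [smul_add, smul_sub, op_smul_op_smul, hmesh, pow_succ, mul_neg_one,
      neg_smul, genB_smul_arrowA_mul_word, ← smul_comm (arrowA k i u) (op _),
      ← smul_comm (arrowB k (i - 1) (u + 1)) (op _), smul_comm ((-1 : ℤ) ^ s) (arrowB k _ _)]
    abel

end Derivatives

variable (k : Type*) [Field k] (n : ℕ) [NeZero n]

section Homotopy

/-- The contracting homotopy in degree `-1`. Like `homotopy₀` and `homotopy₁`, it is a homomorphism
of left modules only. -/
def homotopyε : Gam k n →ₗ[Gam k n] R₀ k n :=
  LinearMap.toSpanSingleton _ _ (unitGen k n)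

/-- The contracting homotopy in degree `0`, which differentiates the right tensor factor. -/
def homotopy₀ : R₀ k n →ₗ[Gam k n] R₁ k n :=
  OuterBimodule.sumLiftLeft fun _ =>
    (wordBasis k n).constr k fun j => wordDeriv k j.1.1.1 j.1.1.2 j.1.2.1 j.1.2.2

/-- The contracting homotopy in degree `1`. It vanishes on the summands belonging to the
arrows `b`, whose products with words are again words. -/
def homotopy₁ : R₁ k n →ₗ[Gam k n] R₂ k n :=
  OuterBimodule.sumLiftLeft (fun x => (wordBasis k n).constr k fun j =>
    meshDeriv k x.1.1 x.1.2 j.1.2.1 j.1.2.2) ∘ₗ LinearMap.fst _ _ _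

variable {k n}

theorem homotopy₀_gen₀_smul_word (i u : ZMod n) (s t : ℕ) :
    homotopy₀ k n (gen₀ k i u <• word k i u s t) = wordDeriv k i u s t := by
  refine (OuterBimodule.sumLiftLeft_sumGen_smul _ _ _).trans ?_
  rw [idem_mul_word]
  by_cases h : Valid i u s t
  · rw [← wordBasis_apply h, Module.Basis.constr_basis]
    exact idem_smul_wordDeriv i u s t
  · rw [word_of_not_valid h, map_zero, smul_zero, wordDeriv_of_not_valid h]

theorem homotopy₁_genA_smul_word {i u : ZMod n} (hu : u ≠ i - 1) (s t : ℕ) :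
    homotopy₁ k n (genA k i u <• word k i u s t) = meshDeriv k i u s t := by
  rw [homotopy₁, genA, dif_pos hu, LinearMap.comp_apply, LinearMap.fst_apply, Prod.smul_fst]
  refine (OuterBimodule.sumLiftLeft_sumGen_smul _ _ _).trans ?_
  rw [idem_mul_word]
  by_cases h : Valid i u s t
  · rw [← wordBasis_apply h, Module.Basis.constr_basis]
    exact idem_smul_meshDeriv i u s t
  · rw [word_of_not_valid h, map_zero, smul_zero, meshDeriv_of_not_valid hu h]

theorem homotopy₁_genB_smul (i u : ZMod n) (x : Gam k n) :
    homotopy₁ k n (genB k i u <• x) = 0 := by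
  rw [genB]
  split_ifs
  · rw [homotopy₁, LinearMap.comp_apply, LinearMap.fst_apply, Prod.smul_fst, smul_zero, map_zero]
  · rw [smul_zero, map_zero]

theorem ε_homotopyε (x : Gam k n) : ε k n (homotopyε k n x) = x := by
  rw [homotopyε, LinearMap.toSpanSingleton_apply, IsBimodule.map_smul_left, ε_unitGen, smul_eq_mul,
    mul_one]

theorem d₁_homotopy₀_add_homotopyε_ε (x : R₀ k n) :
    d₁ k n (homotopy₀ k n x) + homotopyε k n (ε k n x) = x := by
  suffices h : IsBimodule.toLeft (d₁ k n) ∘ₗ homotopy₀ k n +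
      homotopyε k n ∘ₗ IsBimodule.toLeft (ε k n) = LinearMap.id from LinearMap.congr_fun h x
  refine R₀_word_ext fun i u s t => ?_
  change d₁ k n (homotopy₀ k n (gen₀ k i u <• word k i u s t)) +
    homotopyε k n (ε k n (gen₀ k i u <• word k i u s t)) = gen₀ k i u <• word k i u s t
  rw [homotopy₀_gen₀_smul_word, d₁_wordDeriv, IsBimodule.map_smul_right, ε_gen₀, op_smul_eq_mul,
    idem_mul_word, homotopyε, LinearMap.toSpanSingleton_apply, sub_add_cancel]

theorem d₂_homotopy₁_add_homotopy₀_d₁ (x : R₁ k n) :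
    d₂ k n (homotopy₁ k n x) + homotopy₀ k n (d₁ k n x) = x := by
  suffices h : IsBimodule.toLeft (d₂ k n) ∘ₗ homotopy₁ k n +
      homotopy₀ k n ∘ₗ IsBimodule.toLeft (d₁ k n) = LinearMap.id from LinearMap.congr_fun h x
  refine R₁_word_ext (fun i u hu s t => ?_) fun i u _ s t => ?_
  · change d₂ k n (homotopy₁ k n (genA k i u <• word k i u s t)) +
      homotopy₀ k n (d₁ k n (genA k i u <• word k i u s t)) = genA k i u <• word k i u s t
    rw [homotopy₁_genA_smul_word hu, d₂_meshDeriv hu, IsBimodule.map_smul_right, d₁_genA, smul_sub,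
      op_smul_op_smul, arrowA_mul_word hu, ← smul_comm (arrowA k i u), map_sub,
      (homotopy₀ k n).map_smul, homotopy₀_gen₀_smul_word, op_smul, smul_assoc, map_zsmul,
      homotopy₀_gen₀_smul_word]
    abel
  · change d₂ k n (homotopy₁ k n (genB k i u <• word k i u s t)) +
      homotopy₀ k n (d₁ k n (genB k i u <• word k i u s t)) = genB k i u <• word k i u s t
    rw [homotopy₁_genB_smul, map_zero, zero_add, IsBimodule.map_smul_right, d₁_genB, smul_sub,
      op_smul_op_smul, arrowB_mul_word, ← smul_comm (arrowB k i u), map_sub,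
      (homotopy₀ k n).map_smul, homotopy₀_gen₀_smul_word, homotopy₀_gen₀_smul_word, wordDeriv,
      sub_add_cancel, add_sub_cancel_right]

theorem homotopy₁_d₂ (x : R₂ k n) : homotopy₁ k n (d₂ k n x) = x := by
  suffices h : homotopy₁ k n ∘ₗ IsBimodule.toLeft (d₂ k n) = LinearMap.id from
    LinearMap.congr_fun h x
  refine R₂_word_ext fun i u hu s t => ?_
  change homotopy₁ k n (d₂ k n (gen₂ k i u <• word k i u s t)) = gen₂ k i u <• word k i u s t
  have hA : arrowB k (i - 1) u • homotopy₁ k n (genA k i u <• word k i u s t) =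
      arrowB k (i - 1) u • meshDeriv k i u s t := by
    by_cases hu' : u = i - 1
    · rw [arrowB_of_eq hu', zero_smul, zero_smul]
    · rw [homotopy₁_genA_smul_word hu']
  rw [IsBimodule.map_smul_right, d₂_gen₂ hu, meshBoundary]
  simp only [smul_add, op_smul_op_smul, ← smul_comm (arrowA k _ _) (op _),
    ← smul_comm (arrowB k _ _) (op _), map_add, map_smul, homotopy₁_genB_smul, hA, arrowB_mul_word,
    homotopy₁_genA_smul_word (sub_left_injective.ne hu), smul_zero, add_zero]
  rw [meshDeriv, sub_add_cancel, sub_add_cancel]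

end Homotopy

section Minimality

variable {k n} {M : Type*} [AddCommGroup M] [Module (Gam k n) M] [Module (Gam k n)ᵐᵒᵖ M]
  [Module (EnvelopingAlgebra k (Gam k n)) M] [IsBimodule k (Gam k n) M]

theorem smul_mem_jacobson {x : Gam k n} (hx : x ∈ radPow k n 1) (m : M) :
    x • m ∈ Module.jacobson (EnvelopingAlgebra k (Gam k n)) M := by
  rw [← IsBimodule.tmul_one_smul (k := k)]
  exact Ring.jacobson_smul_top_le _ _ (Submodule.smul_mem_smul
    (tmul_one_mem_jacobson radPow_one_mul_top_le radPow_one_pow hx) Submodule.mem_top)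

theorem op_smul_mem_jacobson {x : Gam k n} (hx : x ∈ radPow k n 1) (m : M) :
    m <• x ∈ Module.jacobson (EnvelopingAlgebra k (Gam k n)) M := by
  rw [← IsBimodule.one_tmul_smul (k := k)]
  exact Ring.jacobson_smul_top_le _ _ (Submodule.smul_mem_smul
    (one_tmul_op_mem_jacobson top_mul_radPow_one_le radPow_one_pow hx) Submodule.mem_top)

theorem arrowBoundary_mem_jacobson (i u i' u' : ZMod n) {x : Gam k n} (hx : x ∈ radPow k n 1) :
    arrowBoundary i u i' u' x ∈ Module.jacobson (EnvelopingAlgebra k (Gam k n)) (R₀ k n) :=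
  sub_mem (op_smul_mem_jacobson hx _) (smul_mem_jacobson hx _)

theorem meshBoundary_mem_jacobson (i u : ZMod n) :
    meshBoundary k i u ∈ Module.jacobson (EnvelopingAlgebra k (Gam k n)) (R₁ k n) :=
  add_mem (add_mem (add_mem (op_smul_mem_jacobson (arrowB_mem_radPow_one _ _) _)
    (smul_mem_jacobson (arrowA_mem_radPow_one _ _) _))
    (op_smul_mem_jacobson (arrowA_mem_radPow_one _ _) _))
    (smul_mem_jacobson (arrowB_mem_radPow_one _ _) _)

variable (k n)

theorem range_d₁_le_jacobson :
    (d₁ k n).range ≤ Module.jacobson (EnvelopingAlgebra k (Gam k n)) (R₀ k n) := by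
  rw [d₁, LinearMap.range_coprod, sup_le_iff]
  exact ⟨OuterBimodule.range_sumLift_le fun _ =>
      arrowBoundary_mem_jacobson _ _ _ _ (arrowA_mem_radPow_one _ _),
    OuterBimodule.range_sumLift_le fun _ =>
      arrowBoundary_mem_jacobson _ _ _ _ (arrowB_mem_radPow_one _ _)⟩

theorem range_d₂_le_jacobson :
    (d₂ k n).range ≤ Module.jacobson (EnvelopingAlgebra k (Gam k n)) (R₁ k n) :=
  OuterBimodule.range_sumLift_le fun _ => meshBoundary_mem_jacobson _ _

end Minimality

section Resolution

variable {k n}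

theorem ε_arrowBoundary {i u i' u' : ZMod n} {x : Gam k n} (hx : idem k i u * x = x)
    (hx' : x * idem k i' u' = x) : ε k n (arrowBoundary i u i' u' x) = 0 := by
  rw [arrowBoundary, map_sub, IsBimodule.map_smul_right, IsBimodule.map_smul_left, ε_gen₀, ε_gen₀,
    op_smul_eq_mul, smul_eq_mul, hx, hx', sub_self]

theorem ε_d₁ (x : R₁ k n) : ε k n (d₁ k n x) = 0 := by
  suffices h : IsBimodule.toLeft (ε k n ∘ₗ d₁ k n) = 0 from LinearMap.congr_fun h x
  refine R₁_word_ext (fun i u _ s t => ?_) fun i u _ s t => ?_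
  · change ε k n (d₁ k n (genA k i u <• word k i u s t)) = 0
    rw [IsBimodule.map_smul_right, IsBimodule.map_smul_right, d₁_genA, ← arrowBoundary,
      ε_arrowBoundary (idem_mul_arrowA i u) (arrowA_mul_idem i u), smul_zero]
  · change ε k n (d₁ k n (genB k i u <• word k i u s t)) = 0
    rw [IsBimodule.map_smul_right, IsBimodule.map_smul_right, d₁_genB, ← arrowBoundary,
      ε_arrowBoundary (idem_mul_arrowB i u) (arrowB_mul_idem i u), smul_zero]

theorem d₁_meshBoundary {i u : ZMod n} (h : u ≠ i) : d₁ k n (meshBoundary k i u) = 0 := by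
  have hA : d₁ k n (genA k i (u - 1) <• arrowB k i u + arrowA k i (u - 1) • genB k i u) =
      gen₀ k (i - 1) (u - 1) <• (arrowA k i (u - 1) * arrowB k i u) -
        (arrowA k i (u - 1) * arrowB k i u) • gen₀ k i u := by
    rw [map_add, IsBimodule.map_smul_right, IsBimodule.map_smul_left, d₁_genA, d₁_genB,
      boundary_mul]
  have hB : d₁ k n (genB k (i - 1) u <• arrowA k i u + arrowB k (i - 1) u • genA k i u) =
      gen₀ k (i - 1) (u - 1) <• (arrowB k (i - 1) u * arrowA k i u) -
        (arrowB k (i - 1) u * arrowA k i u) • gen₀ k i u := by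
    rw [map_add, IsBimodule.map_smul_right, IsBimodule.map_smul_left, d₁_genA, d₁_genB,
      boundary_mul]
  rw [meshBoundary, add_assoc, map_add, hA, hB, eq_neg_of_add_eq_zero_right (mesh h), op_neg,
    neg_smul, neg_smul]
  abel

theorem d₁_d₂ (x : R₂ k n) : d₁ k n (d₂ k n x) = 0 := by
  suffices h : IsBimodule.toLeft (d₁ k n ∘ₗ d₂ k n) = 0 from LinearMap.congr_fun h x
  refine R₂_word_ext fun i u hu s t => ?_
  change d₁ k n (d₂ k n (gen₂ k i u <• word k i u s t)) = 0
  rw [IsBimodule.map_smul_right, IsBimodule.map_smul_right, d₂_gen₂ hu, d₁_meshBoundary hu,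
    smul_zero]

theorem idem_ne_zero (i u : ZMod n) : idem k i u ≠ 0 :=
  word_zero_zero k i u ▸ word_ne_zero (valid_zero_zero i u)

instance (j v i u : ZMod n) :
    Module.Projective (EnvelopingAlgebra k (Gam k n)) (ProjBimod k j v i u) :=
  OuterBimodule.projective (isIdempotentElem_idem j v) (isIdempotentElem_idem i u)

variable (k)

theorem nontrivial_R₂ (hn : 2 ≤ n) : Nontrivial (R₂ k n) := by
  have : Fact (1 < n) := ⟨hn⟩
  exact ⟨_, 0, OuterBimodule.sumGen_ne_zero (x := ⟨(0, 1), zero_ne_one⟩) (idem_ne_zero _ _)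
    (idem_ne_zero _ _)⟩

variable (n)

theorem isMinimalProjectiveResolution :
    IsMinimalProjectiveResolution (d₂ k n) (d₁ k n) (ε k n) :=
  .of_contractingHomotopy ε_d₁ d₁_d₂ (homotopyε k n).toAddMonoidHom (homotopy₀ k n).toAddMonoidHom
    (homotopy₁ k n).toAddMonoidHom ε_homotopyε d₁_homotopy₀_add_homotopyε_ε
    d₂_homotopy₁_add_homotopy₀_d₁ homotopy₁_d₂
    (range_d₁_le_jacobson k n) (range_d₂_le_jacobson k n)

end Resolution

end TaftAuslander

end

theorem mainTheorem2_general (k : Type*) [Field k] (n : ℕ) [NeZero n] (hn : 2 ≤ n) :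
    Nontrivial (TaftAuslander.R₂ k n) ∧
    ∃ (d₂ : TaftAuslander.R₂ k n →ₗ[EnvelopingAlgebra k (TaftAuslander.Gam k n)]
          TaftAuslander.R₁ k n)
      (d₁ : TaftAuslander.R₁ k n →ₗ[EnvelopingAlgebra k (TaftAuslander.Gam k n)]
          TaftAuslander.R₀ k n)
      (ε : TaftAuslander.R₀ k n →ₗ[EnvelopingAlgebra k (TaftAuslander.Gam k n)]
          TaftAuslander.Gam k n),
      IsMinimalProjectiveResolution d₂ d₁ ε :=
  ⟨TaftAuslander.nontrivial_R₂ k hn, _, _, _, TaftAuslander.isMinimalProjectiveResolution k n⟩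

theorem mainTheorem2 (k : Type*) [Field k] [IsAlgClosed k] (n : ℕ) [NeZero n] (hn : 2 ≤ n) :
    Nontrivial (TaftAuslander.R₂ k n) ∧
    ∃ (d₂ : TaftAuslander.R₂ k n →ₗ[EnvelopingAlgebra k (TaftAuslander.Gam k n)]
          TaftAuslander.R₁ k n)
      (d₁ : TaftAuslander.R₁ k n →ₗ[EnvelopingAlgebra k (TaftAuslander.Gam k n)]
          TaftAuslander.R₀ k n)
      (ε : TaftAuslander.R₀ k n →ₗ[EnvelopingAlgebra k (TaftAuslander.Gam k n)]
          TaftAuslander.Gam k n),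
      IsMinimalProjectiveResolution d₂ d₁ ε :=
  mainTheorem2_general k n hn
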